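/- Let $(G,\Gamma)$ be a matched pair of groups: groups $G,\Gamma$ with left actions $\rhd_1$ of $G$ on the set $\Gamma$ and $\rhd_2$ of $\Gamma$ on the set $G$ such that $g\rhd_1 e=e$, $s\rhd_2 e=e$, $g\rhd_1(st)=((t\rhd_2 g)\rhd_1 s)(g\rhd_1 t)$ and $s\rhd_2(gh)=((h\rhd_1 s)\rhd_2 g)(s\rhd_2 h)$ for all $g,h\in G$, $s,t\in\Gamma$. A \emph{$(G,\Gamma)$-crossed monoidal category} is an additive monoidal category $\mathcal C$ (with biadditive $\otimes$ and associator $a$) together with the following data. (i) A $\Gamma$-grading $\mathcal C=\bigoplus_{s\in\Gamma}\mathcal C_s$: full replete additive subcategories $\mathcal C_s$ with no nonzero morphisms between $\mathcal C_s$ and $\mathcal C_t$ for $s\ne t$, such that every object is a finite direct sum of objects of the $\mathcal C_s$, and $\mathcal C_s\otimes\mathcal C_t\subset\mathcal C_{st}$. An object of $\mathcal C_s$ is called homogeneous, of degree $\partial\mu=s$. (ii) An action of $G$ on $\mathcal C$ by additive endofunctors $\gamma(g)={}^g(-)$, with coherent natural isomorphisms $\chi_{g,h}:\gamma(g)\gamma(h)\cong\gamma(gh)$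 and $\iota:\mathrm{id}\cong\gamma(e)$, such that ${}^g\mathcal C_s\subset\mathcal C_{g\rhd_1 s}$. (iii) Isomorphisms $J^{g}_{\lambda,\mu}:{}^{\partial\mu\rhd_2 g}\lambda\otimes{}^g\mu\cong{}^g(\lambda\otimes\mu)$ for $g \in G$, $\lambda$ an object and $\mu$ homogeneous, natural in $\lambda$ and $\mu$, and isomorphisms $\varphi^g:\mathbf 1\cong{}^g\mathbf 1$ for $g \in G$, such that, for all $g,h\in G$, all objects $\lambda$ and all homogeneous $\mu,\nu$ (suppressing the unit isomorphisms of $\mathcal C$ and identities between functors $\gamma(g)$ with equal indices), $$ {}^g a_{\lambda,\mu,\nu}\,J^g_{\lambda\mu,\nu}(J^{\partial\nu\rhd_2 g}_{\lambda,\mu}\otimes\mathrm{id})=J^g_{\lambda,\mu\nu}(\mathrm{id}\otimes J^g_{\mu,\nu})\,a,\qquad J^g_{\mathbf 1,\mu}(\varphi^{\partial\mu\rhd_2 g}\otimes\mathrm{id})=\mathrm{id}=J^g_{\mu,\mathbf 1}(\mathrm{id}\otimes\varphi^g),$$ $$(\chi_{g,h})_{\lambda\mu}\,{}^gJ^h_{\lambda,\mu}\,J^g_{{}^{\partial\mu\rhd_2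 h}\lambda,{}^h\mu}=J^{gh}_{\lambda,\mu}\big((\chi_{(h\rhd_1\partial\mu)\rhd_2 g,\,\partial\mu\rhd_2 h})_\lambda\otimes(\chi_{g,h})_\mu\big),$$ $$(\chi_{g,h})_{\mathbf 1}\,{}^g\varphi^h\,\varphi^g=\varphi^{gh},\qquad \iota_{\lambda\mu}=J^e_{\lambda,\mu}(\iota_\lambda\otimes\iota_\mu),\qquad \iota_{\mathbf 1}=\varphi^e.$$ It is \emph{strictly $(G,\Gamma)$-crossed} if the action is strict (that is, $\gamma(g)\gamma(h)=\gamma(gh)$, $\gamma(e)=\mathrm{id}$, and all $\chi_{g,h}$ and $\iota$ are identities) and all $J^g_{\lambda,\mu}$ and $\varphi^g$ are identities. It is \emph{strict monoidal} if its associators and unitors are identities. A \emph{$(G,\Gamma)$-crossed monoidal functor} $F:\mathcal C\to\mathcal D$ is an additive (strong) monoidal functor, with structure isomorphisms $J^F_{\lambda,\mu}:F(\lambda)\otimes F(\mu)\cong F(\lambda\otimes\mu)$ and $\varphi^F:\mathbf 1\cong F(\mathbf 1)$, such that $F(\mathcal C_s)\subset\mathcal D_s$ for all $s \in \Gamma$,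 together with natural isomorphisms $\eta^F_g:F\gamma^{\mathcal C}(g)\cong\gamma^{\mathcal D}(g)F$ for $g \in G$ such that, for all $g,h\in G$, all objects $\lambda$ and all homogeneous $\mu$, $$\eta^F_{gh}(\mathrm{id}_F*\chi^{\mathcal C}_{g,h})=(\chi^{\mathcal D}_{g,h}*\mathrm{id}_F)(\mathrm{id}_{\gamma^{\mathcal D}(g)}*\eta^F_h)(\eta^F_g*\mathrm{id}_{\gamma^{\mathcal C}(h)}),$$ $$(\eta^F_g)_{\lambda\mu}F(J^g_{\lambda,\mu})J^F_{{}^{\partial\mu\rhd_2 g}\lambda,{}^g\mu}={}^gJ^F_{\lambda,\mu}\,J^g_{F\lambda,F\mu}\,((\eta^F_{\partial\mu\rhd_2 g})_\lambda\otimes(\eta^F_g)_\mu).$$ A \emph{$(G,\Gamma)$-crossed natural transformation} $\tau:F\to F'$ is a monoidal natural transformation with $(\mathrm{id}_{\gamma^{\mathcal D}(g)}*\tau)\eta^F_g=\eta^{F'}_g(\tau*\mathrm{id}_{\gamma^{\mathcal C}(g)})$ for all $g$. A crossed monoidal functor $F:\mathcal C\to\mathcal D$ is a \emph{$(G,\Gamma)$-crossed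 monoidal equivalence} if there are a $(G,\Gamma)$-crossed monoidal functor $F^{-1}:\mathcal D\to\mathcal C$ and $(G,\Gamma)$-crossed natural isomorphisms $F^{-1}F\cong\mathrm{id}_{\mathcal C}$ and $FF^{-1}\cong\mathrm{id}_{\mathcal D}$, where composites carry $\eta^{F_2F_1}_g=(\eta^{F_2}_g*\mathrm{id}_{F_1})(\mathrm{id}_{F_2}*\eta^{F_1}_g)$. \textbf{Theorem.} For every matched pair $(G,\Gamma)$ of groups and every $(G,\Gamma)$-crossed monoidal category $\mathcal C$ there are a strictly $(G,\Gamma)$-crossed strict monoidal category $\mathcal D$ and a $(G,\Gamma)$-crossed monoidal equivalence $F:\mathcal C\to\mathcal D$. -/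

import Mathlib

open CategoryTheory CategoryTheory.Limits MonoidalCategory

universe v u v₁ u₁ v₂ u₂ v₃ u₃ w₁ w₂

/-- A matched pair of groups `(G, Γ, ▷₁, ▷₂)`: `lact g s` is `g ▷₁ s` and `ract s g` is `s ▷₂ g`. -/
structure MatchedPair (G : Type w₁) (Γ : Type w₂) [Group G] [Group Γ] where
  /-- the action `▷₁` of `G` on the set `Γ` -/
  lact : G → Γ → Γ
  /-- the action `▷₂` of `Γ` on the set `G` -/
  ract : Γ → G → G
  one_lact : ∀ s, lact 1 s = s
  mul_lact : ∀ g h s, lact (g * h) s = lact g (lact h s)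
  one_ract : ∀ g, ract 1 g = g
  mul_ract : ∀ s t g, ract (s * t) g = ract s (ract t g)
  lact_one : ∀ g, lact g 1 = 1
  ract_one : ∀ s, ract s 1 = 1
  lact_mul : ∀ g s t, lact g (s * t) = lact (ract t g) s * lact g t
  ract_mul : ∀ s g h, ract s (g * h) = ract (lact h s) g * ract s h

/-- A grading of an additive category by a set `I`: a family of full (replete) additive
subcategories, with no nonzero morphisms between different components, such that every object is a
finite direct sum of homogeneous objects. -/
structure Grading (I : Type w₂) (C : Type u) [Category.{v} C] [Preadditive C]
    [HasFiniteBiproducts C] where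
  /-- `homog s X` says that `X` is an object of the component of degree `s` -/
  homog : I → ObjectProperty C
  homog_of_iso : ∀ {s : I} {X Y : C}, (X ≅ Y) → homog s X → homog s Y
  /-- closure under finite direct sums; the case `n = 0` says that zero objects are in `C_s` -/
  homog_biproduct : ∀ {s : I} {n : ℕ} (Y : Fin n → C), (∀ i, homog s (Y i)) → homog s (⨁ Y)
  hom_eq_zero : ∀ {s t : I} {X Y : C}, s ≠ t → homog s X → homog t Y → ∀ f : X ⟶ Y, f = 0
  exists_decomposition : ∀ X : C, ∃ (n : ℕ) (d : Fin n → I) (Y : Fin n → C),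
    (∀ i, homog (d i) (Y i)) ∧ Nonempty (X ≅ ⨁ Y)

/-- A `Γ`-grading on an additive monoidal category, compatible with the monoidal product. -/
structure MonoidalGrading (Γ : Type w₂) [Group Γ] (C : Type u) [Category.{v} C] [Preadditive C]
    [HasFiniteBiproducts C] [MonoidalCategory C] extends Grading Γ C where
  homog_tensor : ∀ {s t : Γ} {X Y : C}, homog s X → homog t Y → homog (s * t) (X ⊗ Y)

/-- In a graded additive monoidal category the unit object is automatically of degree `1`. -/
theorem MonoidalGrading.homog_unit {Γ : Type w₂} [Group Γ] {C : Type u} [Category.{v} C]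
    [Preadditive C] [HasFiniteBiproducts C] [MonoidalCategory C] [MonoidalPreadditive C]
    (A : MonoidalGrading Γ C) : A.homog 1 (𝟙_ C) := by
  obtain ⟨n, d, Y, hY, ⟨e⟩⟩ := A.exists_decomposition (𝟙_ C)
  refine A.homog_of_iso e.symm (A.homog_biproduct Y fun i => ?_)
  by_cases hd : d i = 1
  · exact hd ▸ hY i
  have key : ∀ j, (biproduct.ι Y i ≫ e.inv) ▷ Y j = 0 := by
    intro j
    have h0 : (biproduct.ι Y i ≫ e.inv) ▷ Y j ≫ (λ_ (Y j)).hom = 0 :=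
      A.hom_eq_zero (s := d i * d j) (t := d j) (by simpa using hd)
        (A.homog_tensor (hY i) (hY j)) (hY j) _
    simpa using congrArg (· ≫ (λ_ (Y j)).inv) h0
  have h1 : (biproduct.ι Y i ≫ e.inv) ▷ (⨁ Y) = 0 := by
    have hid : 𝟙 (Y i ⊗ (⨁ Y)) = ∑ j, (Y i ◁ biproduct.π Y j) ≫ (Y i ◁ biproduct.ι Y j) := by
      rw [← MonoidalCategory.whiskerLeft_id, ← biproduct.total, whiskerLeft_sum]
      simp
    rw [← Category.id_comp ((biproduct.ι Y i ≫ e.inv) ▷ (⨁ Y)), hid, Preadditive.sum_comp]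
    refine Finset.sum_eq_zero fun j _ => ?_
    rw [Category.assoc, whisker_exchange, key j, zero_comp, comp_zero]
  have h2 : (biproduct.ι Y i ≫ e.inv) ▷ (𝟙_ C) = 0 := by
    have := whisker_exchange (biproduct.ι Y i ≫ e.inv) e.hom
    rw [h1, comp_zero] at this
    have h3 := congrArg (· ≫ (𝟙_ C) ◁ e.inv) this
    simpa [← MonoidalCategory.whiskerLeft_comp] using h3.symm
  have h4 : biproduct.ι Y i ≫ e.inv = 0 := by
    have := rightUnitor_naturality (biproduct.ι Y i ≫ e.inv)
    rw [h2, zero_comp] at this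
    simpa using congrArg ((ρ_ (Y i)).inv ≫ ·) this.symm
  have h5 : 𝟙 (Y i) = 0 := by
    have : (biproduct.ι Y i ≫ e.inv) ≫ e.hom ≫ biproduct.π Y i = 𝟙 (Y i) := by simp
    rw [← this, h4, zero_comp]
  have hz : IsZero (Y i) := (IsZero.iff_id_eq_zero _).2 h5
  have hz' : IsZero (⨁ (fun k : Fin 0 => k.elim0 : Fin 0 → C)) :=
    (IsZero.iff_id_eq_zero _).2 (biproduct.hom_ext _ _ fun k => k.elim0)
  exact A.homog_of_iso (hz'.iso hz) (A.homog_biproduct _ fun k => k.elim0)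

/-- The identity `γ(g)(X) = γ(g')(X)` for `g = g'`, as a morphism. -/
def transp {G : Type w₁} {C : Type u} [Category.{v} C] (γ : G → C ⥤ C) {g g' : G} (h : g = g')
    (X : C) : (γ g).obj X ⟶ (γ g').obj X :=
  eqToHom (congrArg (fun k => (γ k).obj X) h)

/-- An action of a group `G` on an additive category by additive endofunctors: a monoidal functor
from the discrete monoidal category on `G` to endofunctors, written out.
`χ g h : γ(g) γ(h) ≅ γ(gh)` and `ι : id ≅ γ(e)`. -/
structure CatAction (G : Type w₁) [Group G] (C : Type u) [Category.{v} C] [Preadditive C] where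
  γ : G → C ⥤ C
  additive : ∀ g, (γ g).Additive
  χ : ∀ g h, γ h ⋙ γ g ≅ γ (g * h)
  ι : 𝟭 C ≅ γ 1
  assoc : ∀ g h k X,
    (χ g h).hom.app ((γ k).obj X) ≫ (χ (g * h) k).hom.app X ≫ transp γ (mul_assoc g h k) X =
      (γ g).map ((χ h k).hom.app X) ≫ (χ g (h * k)).hom.app X
  one_left : ∀ g X,
    ι.hom.app ((γ g).obj X) ≫ (χ 1 g).hom.app X ≫ transp γ (one_mul g) X = 𝟙 ((γ g).obj X)
  one_right : ∀ g X,
    (γ g).map (ι.hom.app X) ≫ (χ g 1).hom.app X ≫ transp γ (mul_one g) X = 𝟙 ((γ g).obj X)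

/-- An action is strict if `γ(g) γ(h) = γ(gh)`, `id = γ(e)` and `χ`, `ι` are identities. -/
def CatAction.IsStrict {G : Type w₁} [Group G] {C : Type u} [Category.{v} C] [Preadditive C]
    (A : CatAction G C) : Prop :=
  (∀ g h, ∃ e : A.γ h ⋙ A.γ g = A.γ (g * h), A.χ g h = eqToIso e) ∧
    ∃ e : 𝟭 C = A.γ 1, A.ι = eqToIso e

/-- The structure of a `(G, Γ)`-crossed monoidal category (in the sense of Natale) on an additive
monoidal category `C`. The isomorphism `J g X Y hY` is
`J^{γ(g)}_{X,Y} : γ(s ▷₂ g)(X) ⊗ γ(g)(Y) ≅ γ(g)(X ⊗ Y)` for `Y` homogeneous of degree `s`. -/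
structure CrossedStructure {G : Type w₁} {Γ : Type w₂} [Group G] [Group Γ] (P : MatchedPair G Γ)
    (C : Type u) [Category.{v} C] [Preadditive C] [HasFiniteBiproducts C] [MonoidalCategory C]
    [MonoidalPreadditive C] extends MonoidalGrading Γ C, CatAction G C where
  J : ∀ (g : G) {s : Γ} (X Y : C), homog s Y →
    ((γ (P.ract s g)).obj X ⊗ (γ g).obj Y ≅ (γ g).obj (X ⊗ Y))
  φ : ∀ g : G, 𝟙_ C ≅ (γ g).obj (𝟙_ C)
  J_natural : ∀ (g : G) {s : Γ} {X X' Y Y' : C} (hY : homog s Y) (hY' : homog s Y')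
    (f : X ⟶ X') (k : Y ⟶ Y'),
    ((γ (P.ract s g)).map f ⊗ₘ (γ g).map k) ≫ (J g X' Y' hY').hom =
      (J g X Y hY).hom ≫ (γ g).map (f ⊗ₘ k)
  homog_γ : ∀ (g : G) {s : Γ} {X : C}, homog s X → homog (P.lact g s) ((γ g).obj X)
  J_assoc : ∀ (g : G) {s t : Γ} (X Y Z : C) (hY : homog s Y) (hZ : homog t Z),
    ((J (P.ract t g) X Y hY).hom ▷ (γ g).obj Z) ≫ (J g (X ⊗ Y) Z hZ).hom ≫
        (γ g).map (α_ X Y Z).hom =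
      (α_ _ _ _).hom ≫ (transp γ (P.mul_ract s t g).symm X ⊗ₘ (J g Y Z hZ).hom) ≫
        (J g X (Y ⊗ Z) (homog_tensor hY hZ)).hom
  J_unit_left : ∀ (g : G) {s : Γ} (Y : C) (hY : homog s Y),
    ((φ (P.ract s g)).hom ▷ (γ g).obj Y) ≫ (J g (𝟙_ C) Y hY).hom ≫ (γ g).map (λ_ Y).hom =
      (λ_ ((γ g).obj Y)).hom
  J_unit_right : ∀ (g : G) {s : Γ} (Y : C), homog s Y →
    (transp γ (P.one_ract g).symm Y ⊗ₘ (φ g).hom) ≫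
        (J g Y (𝟙_ C) toMonoidalGrading.homog_unit).hom ≫ (γ g).map (ρ_ Y).hom =
      (ρ_ ((γ g).obj Y)).hom
  J_χ : ∀ (g h : G) {s : Γ} (X Y : C) (hY : homog s Y),
    (J g ((γ (P.ract s h)).obj X) ((γ h).obj Y) (homog_γ h hY)).hom ≫
        (γ g).map (J h X Y hY).hom ≫ (χ g h).hom.app (X ⊗ Y) =
      (((χ (P.ract (P.lact h s) g) (P.ract s h)).hom.app X ≫
          transp γ (P.ract_mul s g h).symm X) ⊗ₘ (χ g h).hom.app Y) ≫ (J (g * h) X Y hY).hom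
  φ_χ : ∀ g h : G,
    (φ g).hom ≫ (γ g).map (φ h).hom ≫ (χ g h).hom.app (𝟙_ C) = (φ (g * h)).hom
  J_ι : ∀ {s : Γ} (X Y : C) (hY : homog s Y),
    ι.hom.app (X ⊗ Y) =
      ((ι.hom.app X ≫ transp γ (P.ract_one s).symm X) ⊗ₘ ι.hom.app Y) ≫ (J 1 X Y hY).hom
  φ_ι : ι.hom.app (𝟙_ C) = (φ 1).hom

/-- A `(G, Γ)`-crossed monoidal category. -/
structure CrossedMonoidalCat {G : Type w₁} {Γ : Type w₂} [Group G] [Group Γ]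
    (P : MatchedPair G Γ) where
  carrier : Type u
  [category : Category.{v} carrier]
  [preadditive : Preadditive carrier]
  [hasFiniteBiproducts : HasFiniteBiproducts carrier]
  [monoidal : MonoidalCategory carrier]
  [monoidalPreadditive : MonoidalPreadditive carrier]
  str : CrossedStructure P carrier

namespace CrossedMonoidalCat

attribute [instance] category preadditive hasFiniteBiproducts monoidal monoidalPreadditive

variable {G : Type w₁} {Γ : Type w₂} [Group G] [Group Γ] {P : MatchedPair G Γ}

/-- The underlying monoidal category is strict: associators and unitors are identities. -/
def IsStrictMonoidal (𝒞 : CrossedMonoidalCat.{v, u} P) : Prop :=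
  (∀ X Y Z : 𝒞.carrier, ∃ e : (X ⊗ Y) ⊗ Z = X ⊗ (Y ⊗ Z), α_ X Y Z = eqToIso e) ∧
    (∀ X : 𝒞.carrier, ∃ e : 𝟙_ 𝒞.carrier ⊗ X = X, λ_ X = eqToIso e) ∧
    ∀ X : 𝒞.carrier, ∃ e : X ⊗ 𝟙_ 𝒞.carrier = X, ρ_ X = eqToIso e

/-- Strictly `(G, Γ)`-crossed: the action is strict and all `J` and `φ` are identities. -/
def IsStrictlyCrossed (𝒞 : CrossedMonoidalCat.{v, u} P) : Prop :=
  𝒞.str.toCatAction.IsStrict ∧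
    (∀ (g : G) (s : Γ) (X Y : 𝒞.carrier) (hY : 𝒞.str.homog s Y),
      ∃ e : (𝒞.str.γ (P.ract s g)).obj X ⊗ (𝒞.str.γ g).obj Y = (𝒞.str.γ g).obj (X ⊗ Y),
        𝒞.str.J g X Y hY = eqToIso e) ∧
    ∀ g : G, ∃ e : 𝟙_ 𝒞.carrier = (𝒞.str.γ g).obj (𝟙_ 𝒞.carrier), 𝒞.str.φ g = eqToIso e

end CrossedMonoidalCat

/-- A `(G, Γ)`-crossed monoidal functor: a `Γ`-graded (additive) monoidal functor `F` with natural
isomorphisms `η g : F γ(g) ≅ γ(g) F`. -/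
structure CrossedFunctor {G : Type w₁} {Γ : Type w₂} [Group G] [Group Γ] {P : MatchedPair G Γ}
    (𝒞 : CrossedMonoidalCat.{v₁, u₁} P) (𝒟 : CrossedMonoidalCat.{v₂, u₂} P) where
  F : 𝒞.carrier ⥤ 𝒟.carrier
  [monoidal : F.Monoidal]
  additive : F.Additive
  homog_F : ∀ {s : Γ} {X : 𝒞.carrier}, 𝒞.str.homog s X → 𝒟.str.homog s (F.obj X)
  η : ∀ g : G, 𝒞.str.γ g ⋙ F ≅ F ⋙ 𝒟.str.γ g
  η_χ : ∀ (g h : G) (X : 𝒞.carrier),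
    F.map ((𝒞.str.χ g h).hom.app X) ≫ (η (g * h)).hom.app X =
      (η g).hom.app ((𝒞.str.γ h).obj X) ≫ (𝒟.str.γ g).map ((η h).hom.app X) ≫
        (𝒟.str.χ g h).hom.app (F.obj X)
  η_J : ∀ (g : G) {s : Γ} (X Y : 𝒞.carrier) (hY : 𝒞.str.homog s Y),
    Functor.LaxMonoidal.μ F ((𝒞.str.γ (P.ract s g)).obj X) ((𝒞.str.γ g).obj Y) ≫
        F.map (𝒞.str.J g X Y hY).hom ≫ (η g).hom.app (X ⊗ Y) =
      ((η (P.ract s g)).hom.app X ⊗ₘ (η g).hom.app Y) ≫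
        (𝒟.str.J g (F.obj X) (F.obj Y) (homog_F hY)).hom ≫
        (𝒟.str.γ g).map (Functor.LaxMonoidal.μ F X Y)

namespace CrossedFunctor

attribute [instance] monoidal

variable {G : Type w₁} {Γ : Type w₂} [Group G] [Group Γ] {P : MatchedPair G Γ}

/-- The identity crossed monoidal functor. -/
def id (𝒞 : CrossedMonoidalCat.{v, u} P) : CrossedFunctor 𝒞 𝒞 where
  F := 𝟭 _
  additive := inferInstance
  homog_F h := h
  η g := Iso.refl (𝒞.str.γ g)
  η_χ g h X := by simp
  η_J g s X Y hY := by simp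

/-- The composition of crossed monoidal functors (first `K`, then `L`). -/
def comp {𝒞 : CrossedMonoidalCat.{v₁, u₁} P} {𝒟 : CrossedMonoidalCat.{v₂, u₂} P}
    {ℰ : CrossedMonoidalCat.{v₃, u₃} P} (K : CrossedFunctor 𝒞 𝒟) (L : CrossedFunctor 𝒟 ℰ) :
    CrossedFunctor 𝒞 ℰ where
  F := K.F ⋙ L.F
  additive := by
    have := K.additive
    have := L.additive
    infer_instance
  homog_F h := L.homog_F (K.homog_F h)
  η g := Functor.isoWhiskerRight (K.η g) L.F ≪≫ Functor.isoWhiskerLeft K.F (L.η g)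
  η_χ g h X := by
    have h1 := congrArg (fun f => L.F.map f) (K.η_χ g h X)
    have h2 := L.η_χ g h (K.F.obj X)
    have h3 := (L.η g).hom.naturality ((K.η h).hom.app X)
    simp only [Functor.map_comp, Functor.comp_obj, Functor.comp_map] at h1 h2 h3
    simp only [Iso.trans_hom, Functor.isoWhiskerRight_hom, Functor.isoWhiskerLeft_hom,
      NatTrans.comp_app, Functor.whiskerRight_app, Functor.whiskerLeft_app, Functor.comp_obj,
      Functor.comp_map, Functor.map_comp, Category.assoc]
    rw [reassoc_of% h1, h2, reassoc_of% h3]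
  η_J g s X Y hY := by
    have h1 := congrArg (fun f => L.F.map f) (K.η_J g X Y hY)
    have h2 := L.η_J g (K.F.obj X) (K.F.obj Y) (K.homog_F hY)
    have h3 := (L.η g).hom.naturality (Functor.LaxMonoidal.μ K.F X Y)
    have h4 := Functor.LaxMonoidal.μ_natural L.F ((K.η (P.ract s g)).hom.app X)
      ((K.η g).hom.app Y)
    simp only [Functor.map_comp, Functor.comp_obj, Functor.comp_map] at h1 h2 h3 h4
    simp only [Iso.trans_hom, Functor.isoWhiskerRight_hom, Functor.isoWhiskerLeft_hom,
      NatTrans.comp_app, Functor.whiskerRight_app, Functor.whiskerLeft_app, Functor.comp_obj,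
      Functor.comp_map, Functor.map_comp, Category.assoc, Functor.LaxMonoidal.comp_μ]
    rw [reassoc_of% h1, h3, ← reassoc_of% h4, reassoc_of% h2]
    simp only [MonoidalCategory.tensorHom_comp_tensorHom_assoc]

/-- A `(G, Γ)`-crossed natural transformation: a monoidal natural transformation compatible with
the isomorphisms `η`. -/
structure IsCrossedNatTrans {𝒞 : CrossedMonoidalCat.{v₁, u₁} P}
    {𝒟 : CrossedMonoidalCat.{v₂, u₂} P} (K L : CrossedFunctor 𝒞 𝒟) (τ : K.F ⟶ L.F) : Prop where
  monoidal : NatTrans.IsMonoidal τ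
  η_comm : ∀ (g : G) (X : 𝒞.carrier),
    (K.η g).hom.app X ≫ (𝒟.str.γ g).map (τ.app X) =
      τ.app ((𝒞.str.γ g).obj X) ≫ (L.η g).hom.app X

/-- A crossed monoidal functor is a `(G, Γ)`-crossed monoidal equivalence if it has an inverse up
to crossed natural isomorphisms. -/
def IsCrossedEquivalence {𝒞 : CrossedMonoidalCat.{v₁, u₁} P} {𝒟 : CrossedMonoidalCat.{v₂, u₂} P}
    (K : CrossedFunctor 𝒞 𝒟) : Prop :=
  ∃ (L : CrossedFunctor 𝒟 𝒞) (ev : (K.comp L).F ≅ (CrossedFunctor.id 𝒞).F)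
    (coev : (CrossedFunctor.id 𝒟).F ≅ (L.comp K).F),
    IsCrossedNatTrans (K.comp L) (CrossedFunctor.id 𝒞) ev.hom ∧
      IsCrossedNatTrans (CrossedFunctor.id 𝒟) (L.comp K) coev.hom

end CrossedFunctor

/-! Objects of the category are replaced by formal expressions on which tensor product and action
satisfy their laws as equalities.

A letter stands for γ(g)(X) with X homogeneous, and g acts on it by left multiplication on the group
element. A word is a formal tensor product of letters. Concatenation is strictly associative, and g
acts on a word by acting on each letter with g twisted by the degree of everything to its right. The
matched pair identities say exactly that this is an action and that it obeys the crossed rule on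
concatenations (`Word.act_mul`, `Word.act_append`). The coherence isomorphisms of the category
compare words with what they denote, and the axioms of a crossed category become coherence of these
comparisons (`Word.μ_assoc`, `Word.ψ_ψ`, `Word.J_ψ`).

Words only denote homogeneous objects, so an object of the model is a finite set of words, read as
their direct sum. Two conditions make this work. All words in one set have the same length, so
concatenation is injective on pairs and the product set indexes the tensor product of the sums. No
word denotes zero, so a homogeneous sum determines the degree of each of its words
(`SumOfWords.deg_eq`), and the crossed rule holds as an equality of sets.

Morphisms between formal objects are morphisms between the objects they denote. The operations are
transported along the comparisons, and all structure isomorphisms become transports along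
equalities, so their coherence is automatic (`IsEqToHom.eq`). Interpretation is then a crossed
functor that is fully faithful and essentially surjective; its inverse inherits a crossed structure
and is the required equivalence (`CrossedFunctor.exists_isCrossedEquivalence`). -/

open Functor.LaxMonoidal

/-! ### Inverting a crossed functor whose underlying functor is an equivalence. -/

namespace CrossedFunctor

variable {G : Type w₁} {Γ : Type w₂} [Group G] [Group Γ] {P : MatchedPair G Γ}
  {𝒞 : CrossedMonoidalCat.{v₁, u₁} P} {𝒟 : CrossedMonoidalCat.{v₂, u₂} P}

section Inverse

variable (E : CrossedFunctor 𝒟 𝒞) [E.F.Full] [E.F.Faithful]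
  (K : 𝒞.carrier ⥤ 𝒟.carrier) (θ : K ⋙ E.F ≅ 𝟭 𝒞.carrier)

/-- For a right inverse `K` of a fully faithful crossed functor, the isomorphism
`K γ(g) X ≅ γ(g) K X`. -/
noncomputable def inverseηApp (g : G) (X : 𝒞.carrier) :
    K.obj ((𝒞.str.γ g).obj X) ≅ (𝒟.str.γ g).obj (K.obj X) :=
  E.F.preimageIso ((θ.app ((𝒞.str.γ g).obj X) : E.F.obj _ ≅ (𝒞.str.γ g).obj X) ≪≫
    ((𝒞.str.γ g).mapIso (θ.app X).symm : _ ≅ (𝒞.str.γ g).obj (E.F.obj (K.obj X))) ≪≫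
      ((E.η g).symm.app (K.obj X) : _ ≅ E.F.obj ((𝒟.str.γ g).obj (K.obj X))))

lemma map_inverseηApp (g : G) (X : 𝒞.carrier) :
    E.F.map (E.inverseηApp K θ g X).hom ≫ (E.η g).hom.app (K.obj X) =
      θ.hom.app ((𝒞.str.γ g).obj X) ≫ (𝒞.str.γ g).map (θ.inv.app X) := by
  rw [inverseηApp, Functor.preimageIso_hom, Functor.map_preimage, Iso.trans_hom, Iso.trans_hom,
    Category.assoc, Category.assoc]
  erw [Iso.inv_hom_id_app]
  erw [Category.comp_id]
  rfl

lemma map_inverseηApp_comp_map (g : G) (X : 𝒞.carrier) :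
    E.F.map (E.inverseηApp K θ g X).hom ≫ (E.η g).hom.app (K.obj X) ≫
        (𝒞.str.γ g).map (θ.hom.app X) = θ.hom.app ((𝒞.str.γ g).obj X) := by
  rw [← Category.assoc, map_inverseηApp, Category.assoc, ← Functor.map_comp, Iso.inv_hom_id_app]
  simp

-- `E` is faithful, and η and γ(θ) are invertible, so morphisms into γ(g)(KX) can be compared in
-- `𝒞`. Every identity for the inverse functor is checked this way, where it reduces to the
-- corresponding identity for `E`.
omit [E.F.Full] in
lemma inverseη_hom_ext {g : G} {A : 𝒟.carrier} {X : 𝒞.carrier}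
    {f k : A ⟶ (𝒟.str.γ g).obj (K.obj X)}
    (h : E.F.map f ≫ (E.η g).hom.app (K.obj X) ≫ (𝒞.str.γ g).map (θ.hom.app X) =
      E.F.map k ≫ (E.η g).hom.app (K.obj X) ≫ (𝒞.str.γ g).map (θ.hom.app X)) : f = k := by
  apply E.F.map_injective
  rwa [← Category.assoc, ← Category.assoc, cancel_mono, cancel_mono] at h

/-- For a right inverse `K` of a fully faithful crossed functor, the natural isomorphism
`K γ(g) ≅ γ(g) K`. -/
noncomputable def inverseη (g : G) : 𝒞.str.γ g ⋙ K ≅ K ⋙ 𝒟.str.γ g :=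
  NatIso.ofComponents (E.inverseηApp K θ g) fun {X Y} f => by
    apply E.inverseη_hom_ext K θ
    have h1 := θ.hom.naturality ((𝒞.str.γ g).map f)
    have h2 := congrArg (𝒞.str.γ g).map (θ.hom.naturality f)
    have h3 := (E.η g).hom.naturality (K.map f)
    simp only [Functor.comp_map, Functor.id_map, Functor.map_comp, Functor.comp_obj,
      Functor.id_obj] at h1 h2 h3
    simp only [Functor.comp_map, Functor.map_comp, Category.assoc, Functor.comp_obj]
    rw [map_inverseηApp_comp_map, h1, reassoc_of% h3, h2,
      ← E.map_inverseηApp_comp_map K θ g X]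
    simp only [Category.assoc]

variable [K.Monoidal] [NatTrans.IsMonoidal θ.hom]

/-- A right inverse of a fully faithful crossed functor, as a crossed functor. -/
noncomputable def inverse (hK : K.Additive)
    (hE : ∀ {s : Γ} {A : 𝒟.carrier}, 𝒞.str.homog s (E.F.obj A) → 𝒟.str.homog s A) :
    CrossedFunctor 𝒞 𝒟 where
  F := K
  additive := hK
  homog_F {s X} h := hE (𝒞.str.homog_of_iso (θ.app X).symm h)
  η := E.inverseη K θ
  η_χ g h X := by
    apply E.inverseη_hom_ext K θ
    have h1 := E.map_inverseηApp_comp_map K θ (g * h) X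
    have h2 := E.map_inverseηApp_comp_map K θ g ((𝒞.str.γ h).obj X)
    have h3 := congrArg (𝒞.str.γ g).map (E.map_inverseηApp_comp_map K θ h X)
    have h4 := E.η_χ g h (K.obj X)
    have h5 := (E.η g).hom.naturality (E.inverseηApp K θ h X).hom
    have h6 := (𝒞.str.χ g h).hom.naturality (θ.hom.app X)
    have h7 := θ.hom.naturality ((𝒞.str.χ g h).hom.app X)
    simp only [Functor.comp_map, Functor.id_map, Functor.map_comp, Functor.comp_obj,
      Functor.id_obj] at h1 h2 h3 h4 h5 h6 h7
    simp only [inverseη, NatIso.ofComponents_hom_app, Functor.map_comp, Category.assoc]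
    rw [h1, h7, reassoc_of% h4, ← h6, reassoc_of% h5, reassoc_of% h3, reassoc_of% h2]
  η_J g s X Y hY := by
    apply E.inverseη_hom_ext K θ
    have h1 := E.map_inverseηApp_comp_map K θ g (X ⊗ Y)
    have h2 := E.map_inverseηApp_comp_map K θ g Y
    have h3 := E.map_inverseηApp_comp_map K θ (P.ract s g) X
    have h4 := E.η_J g (K.obj X) (K.obj Y) (hE (𝒞.str.homog_of_iso (θ.app Y).symm hY))
    have h5 := θ.hom.naturality (𝒞.str.J g X Y hY).hom
    have h6 := (E.η g).hom.naturality (μ K X Y)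
    have h7 := NatTrans.IsMonoidal.tensor (τ := θ.hom) X Y
    have h7' := congrArg (𝒞.str.γ g).map h7
    have h8 := NatTrans.IsMonoidal.tensor (τ := θ.hom) ((𝒞.str.γ (P.ract s g)).obj X)
      ((𝒞.str.γ g).obj Y)
    have h9 := 𝒞.str.J_natural g (𝒞.str.homog_of_iso (θ.app Y).symm hY) hY (θ.hom.app X)
      (θ.hom.app Y)
    have h10 := μ_natural E.F (E.inverseηApp K θ (P.ract s g) X).hom (E.inverseηApp K θ g Y).hom
    simp only [Functor.comp_map, Functor.id_map, Functor.map_comp, Functor.comp_obj,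
      Functor.id_obj, comp_μ, id_μ, Category.comp_id, Category.assoc] at h4 h5 h6 h7 h7' h8 h9 h10
    -- Monoidality of θ concerns the tensorator of the composite, `μ E.F` followed by the image of
    -- `μ K`; precomposing with `μ E.F` produces it.
    rw [← cancel_epi (μ E.F _ _)]
    simp only [inverseη, NatIso.ofComponents_hom_app, Functor.map_comp, Category.assoc]
    rw [h1, h5, reassoc_of% h8, ← reassoc_of% h10, reassoc_of% h6, reassoc_of% h4, h7', ← h9,
      tensorHom_comp_tensorHom_assoc, tensorHom_comp_tensorHom_assoc, Category.assoc,
      Category.assoc, h2, h3]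

/-- For θ the compatibility is the defining equation of the inverse η. For ρ it follows after
applying `E`, from naturality and the triangle identity used at A and at γ(g)A. -/
lemma inverse_isCrossedEquivalence (hK : K.Additive)
    (hE : ∀ {s : Γ} {A : 𝒟.carrier}, 𝒞.str.homog s (E.F.obj A) → 𝒟.str.homog s A)
    (ρ : 𝟭 𝒟.carrier ≅ E.F ⋙ K) (hρ : NatTrans.IsMonoidal ρ.hom)
    (triangle : ∀ A, E.F.map (ρ.hom.app A) ≫ θ.hom.app (E.F.obj A) = 𝟙 _) :
    (E.inverse K θ hK hE).IsCrossedEquivalence := by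
  refine ⟨E, θ, ρ, ⟨inferInstanceAs (NatTrans.IsMonoidal θ.hom), fun g X => ?_⟩,
    ⟨hρ, fun g A => ?_⟩⟩
  · have := E.map_inverseηApp_comp_map K θ g X
    simpa [comp, inverse, inverseη, CrossedFunctor.id] using this
  · have key : (𝒟.str.γ g).map (ρ.hom.app A) = ρ.hom.app ((𝒟.str.γ g).obj A) ≫
        K.map ((E.η g).hom.app A) ≫ (E.inverseηApp K θ g (E.F.obj A)).hom := ?_
    · exact (Category.id_comp _).trans key
    apply E.inverseη_hom_ext K θ
    have h1 := E.map_inverseηApp_comp_map K θ g (E.F.obj A)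
    have h2 := (E.η g).hom.naturality (ρ.hom.app A)
    have h3 := congrArg (𝒞.str.γ g).map (triangle A)
    have h4 := θ.hom.naturality ((E.η g).hom.app A)
    have h5 := triangle ((𝒟.str.γ g).obj A)
    simp only [Functor.comp_map, Functor.id_map, Functor.map_comp, Functor.comp_obj,
      Functor.id_obj] at h1 h2 h3 h4 h5
    simp only [Functor.map_comp, Category.assoc]
    rw [h1, h4, reassoc_of% h5, reassoc_of% h2, h3]
    simp

end Inverse

/-- A crossed functor whose underlying functor is an equivalence, and which reflects the grading,
has an inverse that is a crossed equivalence. -/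
theorem exists_isCrossedEquivalence (E : CrossedFunctor 𝒟 𝒞) [E.F.IsEquivalence]
    (hE : ∀ {s : Γ} {A : 𝒟.carrier}, 𝒞.str.homog s (E.F.obj A) → 𝒟.str.homog s A) :
    ∃ F : CrossedFunctor 𝒞 𝒟, F.IsCrossedEquivalence := by
  let e := E.F.asEquivalence
  let : e.functor.Monoidal := E.monoidal
  -- With the monoidal structure coming from the adjunction, unit and counit are monoidal
  -- transformations.
  let : e.inverse.Monoidal := e.inverseMonoidal
  have : e.IsMonoidal := by
    let := e.toAdjunction.rightAdjointLaxMonoidal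
    have h : e.toAdjunction.IsMonoidal := inferInstance
    exact h
  have : e.functor.Additive := E.additive
  have h1 : NatTrans.IsMonoidal e.counit := inferInstance
  have h2 : NatTrans.IsMonoidal e.unit := inferInstance
  have : NatTrans.IsMonoidal (F₁ := e.inverse ⋙ E.F) e.counitIso.hom := h1
  exact ⟨_, E.inverse_isCrossedEquivalence e.inverse e.counitIso inferInstance hE e.unitIso h2
    fun A => e.functor_unit_comp A⟩

end CrossedFunctor

/-! ### Morphisms that are transports along equalities of objects. -/

namespace CategoryTheory

/-- The morphism `f` is a transport along an equality of objects. -/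
def IsEqToHom {C : Type u} [Category.{v} C] {X Y : C} (f : X ⟶ Y) : Prop :=
  ∃ h : X = Y, f = eqToHom h

namespace IsEqToHom

variable {C : Type u} [Category.{v} C] {D : Type u₁} [Category.{v₁} D]

lemma id (X : C) : IsEqToHom (𝟙 X) := ⟨rfl, rfl⟩

lemma comp {X Y Z : C} {f : X ⟶ Y} {k : Y ⟶ Z} (hf : IsEqToHom f) (hk : IsEqToHom k) :
    IsEqToHom (f ≫ k) := by
  obtain ⟨rfl, rfl⟩ := hf
  obtain ⟨rfl, rfl⟩ := hk
  exact ⟨rfl, by simp⟩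

lemma map (F : C ⥤ D) {X Y : C} {f : X ⟶ Y} (hf : IsEqToHom f) : IsEqToHom (F.map f) := by
  obtain ⟨rfl, rfl⟩ := hf
  exact ⟨rfl, by simp⟩

lemma tensor [MonoidalCategory C] {X Y X' Y' : C} {f : X ⟶ Y} {k : X' ⟶ Y'} (hf : IsEqToHom f)
    (hk : IsEqToHom k) : IsEqToHom (f ⊗ₘ k) := by
  obtain ⟨rfl, rfl⟩ := hf
  obtain ⟨rfl, rfl⟩ := hk
  exact ⟨rfl, by simp⟩

lemma whiskerRight [MonoidalCategory C] {X Y : C} {f : X ⟶ Y} (hf : IsEqToHom f) (Z : C) :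
    IsEqToHom (f ▷ Z) := by
  obtain ⟨rfl, rfl⟩ := hf
  exact ⟨rfl, by simp⟩

/-- Proof irrelevance of the equality of objects. This makes coherence in the strict category
automatic. -/
lemma eq {X Y : C} {f k : X ⟶ Y} (hf : IsEqToHom f) (hk : IsEqToHom k) : f = k := by
  obtain ⟨rfl, rfl⟩ := hf
  obtain ⟨_, rfl⟩ := hk
  rfl

lemma natIso {F K : C ⥤ D} (α : F ≅ K) (h : ∀ X, IsEqToHom (α.hom.app X)) :
    ∃ e : F = K, α = eqToIso e := by
  choose e he using h
  have e' : F = K := Functor.ext e fun X Y f => by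
    rw [← he, ← Category.assoc, ← cancel_mono (eqToHom (e Y)), ← he Y, α.hom.naturality]
    have : eqToHom (e Y).symm ≫ α.hom.app Y = 𝟙 _ := by rw [he]; simp
    simp [this]
  exact ⟨e', by ext X; simp [he, eqToHom_app]⟩

end IsEqToHom

end CategoryTheory

lemma transp_isEqToHom {G : Type w₁} {C : Type u} [Category.{v} C] (γ : G → C ⥤ C) {g g' : G}
    (h : g = g') (X : C) : IsEqToHom (transp γ h X) := ⟨_, rfl⟩

/-! ### From a strict model to a strict crossed monoidal category. -/

/-- A strict model of a crossed monoidal category: objects interpreted in the category, with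
operations that are strictly associative, unital and compatible with the action, and coherent
isomorphisms relating them to the operations of the category. -/
structure StrictModel {G : Type w₁} {Γ : Type w₂} [Group G] [Group Γ] {P : MatchedPair G Γ}
    (𝒞 : CrossedMonoidalCat.{v, u} P) where
  Obj : Type u₂
  ev : Obj → 𝒞.carrier
  exists_ev_iso : ∀ X, ∃ A, Nonempty (ev A ≅ X)
  one : Obj
  tens : Obj → Obj → Obj
  act : G → Obj → Obj
  tens_assoc : ∀ A B C, tens (tens A B) C = tens A (tens B C)
  one_tens : ∀ A, tens one A = A
  tens_one : ∀ A, tens A one = A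
  act_mul : ∀ g h A, act g (act h A) = act (g * h) A
  one_act : ∀ A, act 1 A = A
  act_tens : ∀ g {s : Γ} A B, 𝒞.str.homog s (ev B) →
    act g (tens A B) = tens (act (P.ract s g) A) (act g B)
  act_unit : ∀ g, act g one = one
  ε : 𝟙_ 𝒞.carrier ≅ ev one
  μ : ∀ A B, ev A ⊗ ev B ≅ ev (tens A B)
  ψ : ∀ g A, (𝒞.str.γ g).obj (ev A) ≅ ev (act g A)
  μ_assoc : ∀ A B C, (μ A B).hom ▷ ev C ≫ (μ (tens A B) C).hom ≫
    eqToHom (congrArg ev (tens_assoc A B C)) =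
      (α_ (ev A) (ev B) (ev C)).hom ≫ ev A ◁ (μ B C).hom ≫ (μ A (tens B C)).hom
  ε_μ : ∀ A, ε.hom ▷ ev A ≫ (μ one A).hom ≫ eqToHom (congrArg ev (one_tens A)) = (λ_ (ev A)).hom
  μ_ε : ∀ A, ev A ◁ ε.hom ≫ (μ A one).hom ≫ eqToHom (congrArg ev (tens_one A)) = (ρ_ (ev A)).hom
  ψ_ψ : ∀ g h A, (𝒞.str.γ g).map (ψ h A).hom ≫ (ψ g (act h A)).hom ≫
    eqToHom (congrArg ev (act_mul g h A)) = (𝒞.str.χ g h).hom.app (ev A) ≫ (ψ (g * h) A).hom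
  ι_ψ : ∀ A, 𝒞.str.ι.hom.app (ev A) ≫ (ψ 1 A).hom = eqToHom (congrArg ev (one_act A).symm)
  J_ψ : ∀ g {s : Γ} A B (hB : 𝒞.str.homog s (ev B)),
    (𝒞.str.J g (ev A) (ev B) hB).hom ≫ (𝒞.str.γ g).map (μ A B).hom ≫ (ψ g (tens A B)).hom ≫
        eqToHom (congrArg ev (act_tens g A B hB)) =
      ((ψ (P.ract s g) A).hom ⊗ₘ (ψ g B).hom) ≫ (μ (act (P.ract s g) A) (act g B)).hom

namespace StrictModel

variable {G : Type w₁} {Γ : Type w₂} [Group G] [Group Γ] {P : MatchedPair G Γ}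
  {𝒞 : CrossedMonoidalCat.{v, u} P} (M : StrictModel.{v, u, u₂} 𝒞)

/-- The category of objects of a strict model. -/
abbrev Cat : Type u₂ := InducedCategory 𝒞.carrier M.ev

/-- The interpretation functor of a strict model. -/
abbrev evF : M.Cat ⥤ 𝒞.carrier := inducedFunctor M.ev

instance : M.evF.Additive where
  map_add := rfl

instance : M.evF.EssSurj where
  mem_essImage X := M.exists_ev_iso X

noncomputable instance : M.evF.IsEquivalence where

instance : HasFiniteBiproducts M.Cat :=
  have : HasFiniteProducts M.Cat :=
    ⟨fun _ => Adjunction.hasLimitsOfShape_of_equivalence M.evF⟩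
  HasFiniteBiproducts.of_hasFiniteProducts

/-- Associator and unitors are transports by fiat. The fields `μ_assoc`, `ε_μ` and `μ_ε` say that
they are also the ones pulled back along interpretation, whence the monoidal axioms. -/
instance : MonoidalCategoryStruct M.Cat where
  tensorObj A B := M.tens A B
  tensorUnit := M.one
  whiskerLeft A _ _ f := InducedCategory.homMk ((M.μ _ _).inv ≫ M.ev A ◁ f.hom ≫ (M.μ _ _).hom)
  whiskerRight f B := InducedCategory.homMk ((M.μ _ _).inv ≫ f.hom ▷ M.ev B ≫ (M.μ _ _).hom)
  tensorHom f k := InducedCategory.homMk ((M.μ _ _).inv ≫ (f.hom ⊗ₘ k.hom) ≫ (M.μ _ _).hom)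
  associator A B C := eqToIso (M.tens_assoc A B C)
  leftUnitor A := eqToIso (M.one_tens A)
  rightUnitor A := eqToIso (M.tens_one A)

/-- The data making the interpretation functor monoidal. -/
def inducingData : Monoidal.InducingFunctorData M.evF where
  μIso := M.μ
  εIso := M.ε
  whiskerLeft_eq _ _ _ _ := rfl
  whiskerRight_eq _ _ := rfl
  tensorHom_eq _ _ := rfl
  associator_eq A B C := by
    refine (InducedCategory.eqToHom_hom (M.tens_assoc A B C)).trans ?_
    rw [← cancel_epi (M.μ (M.tens A B) C).hom, ← cancel_epi ((M.μ A B).hom ▷ M.ev C)]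
    refine (M.μ_assoc A B C).trans ?_
    symm
    change (M.μ A B).hom ▷ M.ev C ≫ (M.μ (M.tens A B) C).hom ≫
      ((M.μ (M.tens A B) C).inv ≫ ((M.μ A B).inv ⊗ₘ 𝟙 (M.ev C))) ≫
      (α_ (M.ev A) (M.ev B) (M.ev C)).hom ≫ (𝟙 (M.ev A) ⊗ₘ (M.μ B C).hom) ≫
        (M.μ A (M.tens B C)).hom = _
    simp
  leftUnitor_eq A := by
    refine (InducedCategory.eqToHom_hom (M.one_tens A)).trans ?_
    rw [← cancel_epi (M.μ M.one A).hom, ← cancel_epi (M.ε.hom ▷ M.ev A)]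
    refine (M.ε_μ A).trans ?_
    symm
    change M.ε.hom ▷ M.ev A ≫ (M.μ M.one A).hom ≫
      ((M.μ M.one A).inv ≫ (M.ε.inv ⊗ₘ 𝟙 (M.ev A))) ≫ (λ_ (M.ev A)).hom = _
    simp
  rightUnitor_eq A := by
    refine (InducedCategory.eqToHom_hom (M.tens_one A)).trans ?_
    rw [← cancel_epi (M.μ A M.one).hom, ← cancel_epi (M.ev A ◁ M.ε.hom)]
    refine (M.μ_ε A).trans ?_
    symm
    change M.ev A ◁ M.ε.hom ≫ (M.μ A M.one).hom ≫
      ((M.μ A M.one).inv ≫ (𝟙 (M.ev A) ⊗ₘ M.ε.inv)) ≫ (ρ_ (M.ev A)).hom = _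
    simp

instance : MonoidalCategory M.Cat := Monoidal.induced M.evF M.inducingData

instance : M.evF.Monoidal := Monoidal.fromInducedMonoidal M.evF M.inducingData

instance : MonoidalPreadditive M.Cat := monoidalPreadditive_of_faithful M.evF

/-- The action on a strict model. -/
def γ (g : G) : M.Cat ⥤ M.Cat where
  obj A := M.act g A
  map f := InducedCategory.homMk ((M.ψ g _).inv ≫ (𝒞.str.γ g).map f.hom ≫ (M.ψ g _).hom)
  map_id A := InducedCategory.hom_ext (by simp)
  map_comp f k := InducedCategory.hom_ext (by simp)

lemma γ_map_hom (g : G) {A B : M.Cat} (f : A ⟶ B) :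
    ((M.γ g).map f).hom = (M.ψ g A).inv ≫ (𝒞.str.γ g).map f.hom ≫ (M.ψ g B).hom := rfl

/-- The grading on a strict model. -/
def grading : MonoidalGrading Γ M.Cat where
  homog s A := 𝒞.str.homog s (M.ev A)
  homog_of_iso e h := 𝒞.str.homog_of_iso (M.evF.mapIso e) h
  homog_biproduct Y h := 𝒞.str.homog_of_iso (M.evF.mapBiproduct Y).symm
    (𝒞.str.homog_biproduct _ h)
  hom_eq_zero hst hX hY f := InducedCategory.hom_ext (𝒞.str.hom_eq_zero hst hX hY f.hom)
  exists_decomposition A := by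
    obtain ⟨n, d, Y, hY, ⟨e⟩⟩ := 𝒞.str.exists_decomposition (M.ev A)
    choose B hB using fun i => M.exists_ev_iso (Y i)
    refine ⟨n, d, B, fun i => 𝒞.str.homog_of_iso (hB i).some.symm (hY i), ⟨M.evF.preimageIso ?_⟩⟩
    exact e ≪≫ biproduct.mapIso (fun i => (hB i).some.symm) ≪≫
      (M.evF.mapBiproduct (B : Fin n → M.Cat)).symm
  homog_tensor hX hY := 𝒞.str.homog_of_iso (M.μ _ _) (𝒞.str.homog_tensor hX hY)

instance (g : G) : (M.γ g).Additive where
  map_add {A B f k} := InducedCategory.hom_ext (by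
    have := 𝒞.str.additive g
    have h : (f + k).hom = f.hom + k.hom := rfl
    rw [γ_map_hom, h, Functor.map_add, Preadditive.add_comp, Preadditive.comp_add]
    rfl)

/-- Transport along an equality of objects of a strict model. -/
def isoOfEq {A B : M.Obj} (h : A = B) : (show M.Cat from A) ≅ (show M.Cat from B) :=
  InducedCategory.isoMk (eqToIso (congrArg M.ev h))

/-- `isoOfEq` is built so that its underlying morphism in `𝒞` is a transport by definition; this
identifies it with the transport in the model. -/
lemma isoOfEq_eq {A B : M.Cat} (h : A = B) : M.isoOfEq h = eqToIso h := by
  subst h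
  rfl

lemma isEqToHom_isoOfEq {A B : M.Cat} (h : A = B) : IsEqToHom (M.isoOfEq h).hom :=
  ⟨h, by rw [isoOfEq_eq]; rfl⟩

/-- The composition isomorphisms of the action on a strict model. -/
def γComp (g h : G) : M.γ h ⋙ M.γ g ≅ M.γ (g * h) :=
  NatIso.ofComponents (fun A => M.isoOfEq (M.act_mul g h A)) fun {A B} f =>
    InducedCategory.hom_ext (by
      have h1 := (𝒞.str.χ g h).hom.naturality f.hom
      simp only [Functor.comp_obj, Functor.comp_map] at h1
      change ((M.ψ g (M.act h A)).inv ≫ (𝒞.str.γ g).map ((M.ψ h A).inv ≫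
          (𝒞.str.γ h).map f.hom ≫ (M.ψ h B).hom) ≫ (M.ψ g (M.act h B)).hom) ≫
          eqToHom (congrArg M.ev (M.act_mul g h B)) =
        eqToHom (congrArg M.ev (M.act_mul g h A)) ≫ (M.ψ (g * h) A).inv ≫
          (𝒞.str.γ (g * h)).map f.hom ≫ (M.ψ (g * h) B).hom
      simp only [Functor.map_comp, Category.assoc, M.ψ_ψ g h B]
      rw [reassoc_of% h1, Iso.inv_comp_eq, ← Functor.mapIso_inv, Iso.inv_comp_eq]
      simp only [Functor.mapIso_hom]
      rw [reassoc_of% M.ψ_ψ g h A, Iso.hom_inv_id_assoc])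

lemma isEqToHom_γComp (g h : G) (A : M.Cat) : IsEqToHom ((M.γComp g h).hom.app A) :=
  M.isEqToHom_isoOfEq (M.act_mul g h A)

/-- The unit isomorphism of the action on a strict model. -/
def γOne : 𝟭 M.Cat ≅ M.γ 1 :=
  NatIso.ofComponents (fun A => M.isoOfEq (M.one_act A).symm) fun {A B} f =>
    InducedCategory.hom_ext (by
      have h1 := 𝒞.str.ι.hom.naturality f.hom
      simp only [Functor.id_obj, Functor.id_map] at h1
      change f.hom ≫ eqToHom (congrArg M.ev (M.one_act B).symm) =
        eqToHom (congrArg M.ev (M.one_act A).symm) ≫ (M.ψ 1 A).inv ≫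
          (𝒞.str.γ 1).map f.hom ≫ (M.ψ 1 B).hom
      rw [← M.ι_ψ A, ← M.ι_ψ B, reassoc_of% h1, Category.assoc, Iso.hom_inv_id_assoc])

lemma isEqToHom_γOne (A : M.Cat) : IsEqToHom (M.γOne.hom.app A) :=
  M.isEqToHom_isoOfEq (M.one_act A).symm

/-- The strict action on a strict model. -/
def action : CatAction G M.Cat where
  γ := M.γ
  additive := inferInstance
  χ := M.γComp
  ι := M.γOne
  assoc _ _ _ _ := IsEqToHom.eq
    (.comp (M.isEqToHom_γComp ..) (.comp (M.isEqToHom_γComp ..) (transp_isEqToHom ..)))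
    (.comp (.map _ (M.isEqToHom_γComp ..)) (M.isEqToHom_γComp ..))
  one_left _ _ := IsEqToHom.eq
    (.comp (M.isEqToHom_γOne _) (.comp (M.isEqToHom_γComp ..) (transp_isEqToHom ..))) (.id _)
  one_right _ _ := IsEqToHom.eq
    (.comp (.map _ (M.isEqToHom_γOne _)) (.comp (M.isEqToHom_γComp ..) (transp_isEqToHom ..)))
    (.id _)

lemma isEqToHom_associator (A B C : M.Cat) : IsEqToHom (α_ A B C).hom :=
  ⟨M.tens_assoc A B C, rfl⟩

lemma isEqToHom_leftUnitor (A : M.Cat) : IsEqToHom (λ_ A).hom := ⟨M.one_tens A, rfl⟩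

lemma isEqToHom_rightUnitor (A : M.Cat) : IsEqToHom (ρ_ A).hom := ⟨M.tens_one A, rfl⟩

/-- The structure isomorphism `γ(s ▷ g) A ⊗ γ(g) B ≅ γ(g)(A ⊗ B)` on a strict model. -/
def γTensor (g : G) {s : Γ} (A B : M.Cat) (hB : 𝒞.str.homog s (M.ev B)) :
    (M.γ (P.ract s g)).obj A ⊗ (M.γ g).obj B ≅ (M.γ g).obj (A ⊗ B) :=
  M.isoOfEq (M.act_tens g A B hB).symm

lemma isEqToHom_γTensor (g : G) {s : Γ} (A B : M.Cat) (hB : 𝒞.str.homog s (M.ev B)) :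
    IsEqToHom (M.γTensor g A B hB).hom := M.isEqToHom_isoOfEq (M.act_tens g A B hB).symm

/-- The axiom `J_ψ` solved for the inverses of ψ. It gives naturality of the strict J, and it is the
compatibility of interpretation with J. -/
lemma γTensor_comp (g : G) {s : Γ} (A B : M.Cat) (hB : 𝒞.str.homog s (M.ev B)) :
    (M.μ (M.act (P.ract s g) A) (M.act g B)).hom ≫
      (eqToHom (congrArg M.ev (M.act_tens g A B hB).symm)) ≫ (M.ψ g (M.tens A B)).inv =
      ((M.ψ (P.ract s g) A).inv ⊗ₘ (M.ψ g B).inv) ≫ (𝒞.str.J g (M.ev A) (M.ev B) hB).hom ≫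
        (𝒞.str.γ g).map (M.μ A B).hom := by
  have h := M.J_ψ g A B hB
  rw [← cancel_epi ((M.ψ (P.ract s g) A).hom ⊗ₘ (M.ψ g B).hom), ← reassoc_of% h]
  simp

/-- The structure isomorphism `𝟙 ≅ γ(g) 𝟙` on a strict model. -/
def γUnit (g : G) : 𝟙_ M.Cat ≅ (M.γ g).obj (𝟙_ M.Cat) := M.isoOfEq (M.act_unit g).symm

lemma isEqToHom_γUnit (g : G) : IsEqToHom (M.γUnit g).hom :=
  M.isEqToHom_isoOfEq (M.act_unit g).symm

/-- The strictly crossed structure on a strict model. -/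
def crossedStructure : CrossedStructure P M.Cat where
  toMonoidalGrading := M.grading
  toCatAction := M.action
  J g _ := M.γTensor g
  φ := M.γUnit
  J_natural g {s A A' B B'} hB hB' f k := InducedCategory.hom_ext (by
    have h1 := M.γTensor_comp g A B hB
    have h2 := M.γTensor_comp g A' B' hB'
    have h3 := 𝒞.str.J_natural g hB hB' f.hom k.hom
    change ((M.μ _ _).inv ≫ (((M.ψ _ _).inv ≫ (𝒞.str.γ _).map f.hom ≫ (M.ψ _ _).hom) ⊗ₘ
        ((M.ψ _ _).inv ≫ (𝒞.str.γ _).map k.hom ≫ (M.ψ _ _).hom)) ≫ (M.μ _ _).hom) ≫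
        eqToHom (congrArg M.ev (M.act_tens g A' B' hB').symm) =
      eqToHom (congrArg M.ev (M.act_tens g A B hB).symm) ≫ (M.ψ g _).inv ≫
        (𝒞.str.γ g).map ((M.μ A B).inv ≫ (f.hom ⊗ₘ k.hom) ≫ (M.μ A' B').hom) ≫ (M.ψ g _).hom
    rw [← cancel_mono (M.ψ g (M.tens A' B')).inv, ← cancel_epi (M.μ _ _).hom]
    simp only [Category.assoc, Iso.hom_inv_id_assoc, Iso.hom_inv_id, Category.comp_id, h2,
      reassoc_of% h1, Functor.map_comp, ← tensorHom_comp_tensorHom, Iso.map_hom_inv_id_assoc]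
    rw [← reassoc_of% h3]
    simp [tensorHom_comp_tensorHom_assoc])
  homog_γ g {s A} hA := 𝒞.str.homog_of_iso (M.ψ g A) (𝒞.str.homog_γ g hA)
  -- Here and in the remaining coherence axioms, both sides are composites of transports.
  J_assoc g {s t} X Y Z hY hZ := IsEqToHom.eq
    (.comp (.whiskerRight (M.isEqToHom_γTensor ..) _)
      (.comp (M.isEqToHom_γTensor ..) (.map _ (M.isEqToHom_associator ..))))
    (.comp (M.isEqToHom_associator ..)
      (.comp (.tensor (transp_isEqToHom ..) (M.isEqToHom_γTensor ..)) (M.isEqToHom_γTensor ..)))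
  J_unit_left g s Y hY := IsEqToHom.eq
    (.comp (.whiskerRight (M.isEqToHom_γUnit _) _)
      (.comp (M.isEqToHom_γTensor ..) (.map _ (M.isEqToHom_leftUnitor _))))
    (M.isEqToHom_leftUnitor _)
  J_unit_right g s Y hY := IsEqToHom.eq
    (.comp (.tensor (transp_isEqToHom ..) (M.isEqToHom_γUnit _))
      (.comp (M.isEqToHom_γTensor ..) (.map _ (M.isEqToHom_rightUnitor _))))
    (M.isEqToHom_rightUnitor _)
  J_χ g h s X Y hY := IsEqToHom.eq
    (.comp (M.isEqToHom_γTensor ..)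
      (.comp (.map _ (M.isEqToHom_γTensor ..)) (M.isEqToHom_γComp ..)))
    (.comp (.tensor (.comp (M.isEqToHom_γComp ..) (transp_isEqToHom ..))
      (M.isEqToHom_γComp ..)) (M.isEqToHom_γTensor ..))
  φ_χ g h := IsEqToHom.eq
    (.comp (M.isEqToHom_γUnit _) (.comp (.map _ (M.isEqToHom_γUnit _)) (M.isEqToHom_γComp ..)))
    (M.isEqToHom_γUnit _)
  J_ι X Y hY := IsEqToHom.eq (M.isEqToHom_γOne _)
    (.comp (.tensor (.comp (M.isEqToHom_γOne _) (transp_isEqToHom ..)) (M.isEqToHom_γOne _))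
      (M.isEqToHom_γTensor ..))
  φ_ι := IsEqToHom.eq (M.isEqToHom_γOne _) (M.isEqToHom_γUnit _)

/-- The strict crossed monoidal category defined by a strict model. -/
@[reducible]
def crossedCat : CrossedMonoidalCat.{v, u₂} P where
  carrier := M.Cat
  str := M.crossedStructure

lemma crossedCat_isStrictMonoidal : M.crossedCat.IsStrictMonoidal :=
  ⟨fun A B C => ⟨M.tens_assoc A B C, rfl⟩, fun A => ⟨M.one_tens A, rfl⟩,
    fun A => ⟨M.tens_one A, rfl⟩⟩

lemma crossedCat_isStrictlyCrossed : M.crossedCat.IsStrictlyCrossed :=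
  ⟨⟨fun g h => IsEqToHom.natIso (M.γComp g h) (M.isEqToHom_γComp g h),
    IsEqToHom.natIso M.γOne M.isEqToHom_γOne⟩,
    fun g _ A B hB => ⟨_, M.isoOfEq_eq (M.act_tens g A B hB).symm⟩,
    fun g => ⟨_, M.isoOfEq_eq (M.act_unit g).symm⟩⟩

/-- The natural isomorphism `ev γ(g) ≅ γ(g) ev` of a strict model. -/
def evη (g : G) : M.γ g ⋙ M.evF ≅ M.evF ⋙ 𝒞.str.γ g :=
  NatIso.ofComponents (fun A => (M.ψ g A).symm) fun f => by
    change ((M.ψ g _).inv ≫ (𝒞.str.γ g).map f.hom ≫ (M.ψ g _).hom) ≫ (M.ψ g _).inv =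
      (M.ψ g _).inv ≫ (𝒞.str.γ g).map f.hom
    simp

/-- The interpretation functor of a strict model as a crossed functor. -/
def crossedFunctor : CrossedFunctor M.crossedCat 𝒞 where
  F := M.evF
  monoidal := Monoidal.fromInducedMonoidal M.evF M.inducingData
  additive := ⟨rfl⟩
  homog_F {s A} h := show 𝒞.str.homog s (M.ev A) from h
  η := M.evη
  η_χ g h A := by
    have h1 := M.ψ_ψ g h A
    change eqToHom (congrArg M.ev (M.act_mul g h A)) ≫ (M.ψ (g * h) A).inv =
      (M.ψ g (M.act h A)).inv ≫ (𝒞.str.γ g).map (M.ψ h A).inv ≫ (𝒞.str.χ g h).hom.app (M.ev A)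
    rw [Iso.eq_inv_comp, ← Functor.mapIso_inv, Iso.eq_inv_comp, Functor.mapIso_hom,
      reassoc_of% h1, Iso.hom_inv_id, Category.comp_id]
  η_J g s A B hB := M.γTensor_comp g A B hB

/-- A crossed monoidal category with a strict model is equivalent to a strict one. -/
theorem exists_equivalence (M : StrictModel.{v, u, u₂} 𝒞) :
    ∃ 𝒟 : CrossedMonoidalCat.{v, u₂} P, 𝒟.IsStrictMonoidal ∧ 𝒟.IsStrictlyCrossed ∧
      ∃ F : CrossedFunctor 𝒞 𝒟, F.IsCrossedEquivalence := by
  have : M.crossedFunctor.F.IsEquivalence := inferInstanceAs M.evF.IsEquivalence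
  exact ⟨M.crossedCat, M.crossedCat_isStrictMonoidal, M.crossedCat_isStrictlyCrossed,
    M.crossedFunctor.exists_isCrossedEquivalence fun h => h⟩

end StrictModel

/-! ### Changing the group element or degree along an equality. -/

section Transp

variable {G : Type w₁} {C : Type u} [Category.{v} C]

lemma transp_refl (γ : G → C ⥤ C) {g : G} (h : g = g) (X : C) : transp γ h X = 𝟙 _ := rfl

lemma transp_transp (γ : G → C ⥤ C) {g g' g'' : G} (h : g = g') (h' : g' = g'') (X : C) :
    transp γ h X ≫ transp γ h' X = transp γ (h.trans h') X := by
  subst h h'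
  simp [transp]

/-- The degree enters the source of J through s ▷₂ g, so rewriting it costs a transport on the first
factor. Needed because degrees of composite words agree only propositionally. -/
lemma CrossedStructure.J_congr {Γ : Type w₂} [Group G] [Group Γ] {P : MatchedPair G Γ}
    [Preadditive C] [HasFiniteBiproducts C] [MonoidalCategory C] [MonoidalPreadditive C]
    (A : CrossedStructure P C) (g : G) {s t : Γ} (h : s = t) (X Y : C) (hs : A.homog s Y)
    (ht : A.homog t Y) :
    (A.J g X Y hs).hom =
      transp A.γ (congrArg (P.ract · g) h) X ▷ (A.γ g).obj Y ≫ (A.J g X Y ht).hom := by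
  subst h
  simp [transp]

end Transp

/-! ### Letters and words. -/

section Words

variable {G : Type w₁} {Γ : Type w₂} [Group G] [Group Γ] {P : MatchedPair G Γ}

/-- A formal expression `γ(elt)(obj)` for a homogeneous object `obj`, with a label that allows for
repetitions. -/
structure Letter (𝒞 : CrossedMonoidalCat.{v, u} P) : Type (max u v w₁ w₂) where
  label : ℕ
  elt : G
  deg : Γ
  obj : 𝒞.carrier
  homog : 𝒞.str.homog deg obj

variable {𝒞 : CrossedMonoidalCat.{v, u} P}

namespace Letter

/-- The interpretation of a letter. -/
@[reducible]
def ev (l : Letter 𝒞) : 𝒞.carrier := (𝒞.str.γ l.elt).obj l.obj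

/-- The degree of the interpretation of a letter. -/
def degree (l : Letter 𝒞) : Γ := P.lact l.elt l.deg

lemma homog_ev (l : Letter 𝒞) : 𝒞.str.homog l.degree l.ev := 𝒞.str.homog_γ l.elt l.homog

/-- The action of the group on letters. -/
@[reducible]
def act (g : G) (l : Letter 𝒞) : Letter 𝒞 := { l with elt := g * l.elt }

lemma degree_act (g : G) (l : Letter 𝒞) : (l.act g).degree = P.lact g l.degree :=
  P.mul_lact _ _ _

lemma act_mul (g h : G) (l : Letter 𝒞) : (l.act h).act g = l.act (g * h) := by
  simp [act, mul_assoc]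

lemma one_act (l : Letter 𝒞) : l.act 1 = l := by simp [act]

/-- The isomorphism between the action on the interpretation of a letter and the interpretation of
the action on the letter. -/
def ψ (g : G) (l : Letter 𝒞) : (𝒞.str.γ g).obj l.ev ≅ (l.act g).ev :=
  (𝒞.str.χ g l.elt).app l.obj

lemma transp_ψ {g g' : G} (h : g = g') (l : Letter 𝒞) :
    transp 𝒞.str.γ h l.ev ≫ (l.ψ g').hom =
      (l.ψ g).hom ≫ eqToHom (congrArg (fun k => (l.act k).ev) h) := by
  subst h
  simp [transp]

/-- Associativity of χ for the triple g, h, `l.elt`, evaluated at `l.obj`. -/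
lemma map_ψ (g h : G) (l : Letter 𝒞) :
    (𝒞.str.γ g).map (l.ψ h).hom ≫ ((l.act h).ψ g).hom ≫ eqToHom (congrArg ev (l.act_mul g h)) =
      (𝒞.str.χ g h).hom.app l.ev ≫ (l.ψ (g * h)).hom := by
  have h1 := 𝒞.str.assoc g h l.elt l.obj
  change (𝒞.str.γ g).map ((𝒞.str.χ h l.elt).hom.app l.obj) ≫
    (𝒞.str.χ g (h * l.elt)).hom.app l.obj ≫ _ =
      (𝒞.str.χ g h).hom.app ((𝒞.str.γ l.elt).obj l.obj) ≫ (𝒞.str.χ (g * h) l.elt).hom.app l.obj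
  rw [← reassoc_of% h1]
  exact congrArg _ ((congrArg _ (transp_transp 𝒞.str.γ (mul_assoc g h l.elt)
    (mul_assoc g h l.elt).symm l.obj)).trans (Category.comp_id _))

lemma ι_ψ (l : Letter 𝒞) :
    𝒞.str.ι.hom.app l.ev ≫ (l.ψ 1).hom = eqToHom (congrArg ev l.one_act.symm) := by
  have h1 := 𝒞.str.one_left l.elt l.obj
  rw [← Category.assoc] at h1
  change 𝒞.str.ι.hom.app ((𝒞.str.γ l.elt).obj l.obj) ≫ (𝒞.str.χ 1 l.elt).hom.app l.obj =
    transp 𝒞.str.γ (one_mul l.elt).symm l.obj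
  have h2 := congrArg (· ≫ transp 𝒞.str.γ (one_mul l.elt).symm l.obj) h1
  simp only [Category.assoc, transp_transp, transp_refl] at h2
  exact (Category.comp_id _).symm.trans ((Category.assoc _ _ _).trans (h2.trans (Category.id_comp _)))

end Letter

namespace Word

/-- The interpretation of a word of letters. -/
@[reducible]
def ev : List (Letter 𝒞) → 𝒞.carrier
  | [] => 𝟙_ 𝒞.carrier
  | l :: w => l.ev ⊗ ev w

/-- The degree of a word. -/
def deg : List (Letter 𝒞) → Γ
  | [] => 1
  | l :: w => l.degree * deg w

lemma homog_ev : ∀ w : List (Letter 𝒞), 𝒞.str.homog (deg w) (ev w)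
  | [] => 𝒞.str.homog_unit
  | l :: w => 𝒞.str.homog_tensor l.homog_ev (homog_ev w)

lemma deg_append (a b : List (Letter 𝒞)) : deg (a ++ b) = deg a * deg b := by
  induction a with
  | nil => simp [deg]
  | cons l a ih => simp [deg, ih, mul_assoc]

/-- The action of the group on words. -/
@[reducible]
def act (g : G) : List (Letter 𝒞) → List (Letter 𝒞)
  | [] => []
  | l :: w => l.act (P.ract (deg w) g) :: act g w

lemma length_act (g : G) (w : List (Letter 𝒞)) : (act g w).length = w.length := by
  induction w with
  | nil => rfl
  | cons l w ih => simp [act, ih]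

lemma deg_act (g : G) (w : List (Letter 𝒞)) : deg (act g w) = P.lact g (deg w) := by
  induction w with
  | nil => exact (P.lact_one g).symm
  | cons l w ih => simp [deg, ih, P.lact_mul, Letter.degree_act]

/-- On the first letter, h is twisted by the degree of the tail and g by the degree of the tail
after h has acted; `ract_mul` identifies the product with the twist of gh. -/
lemma act_mul (g h : G) (w : List (Letter 𝒞)) : act g (act h w) = act (g * h) w := by
  induction w with
  | nil => rfl
  | cons l w ih => simp [act, ih, deg_act, P.ract_mul, Letter.act_mul]

lemma one_act (w : List (Letter 𝒞)) : act 1 w = w := by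
  induction w with
  | nil => rfl
  | cons l w ih => simp [act, ih, P.ract_one, Letter.one_act]

/-- A letter of `a` also sees all of `b` to its right, and ▷₂ is an action, so the twist by `deg b`
can be made first. -/
lemma act_append (g : G) (a b : List (Letter 𝒞)) :
    act g (a ++ b) = act (P.ract (deg b) g) a ++ act g b := by
  induction a with
  | nil => rfl
  | cons l a ih => simp [act, ih, deg_append, P.mul_ract]

/-- The product of the interpretations of two words. -/
def μ : ∀ a b : List (Letter 𝒞), ev a ⊗ ev b ≅ ev (a ++ b)
  | [], b => λ_ (ev b)
  | l :: a, b => α_ l.ev (ev a) (ev b) ≪≫ whiskerLeftIso l.ev (μ a b)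

/-- The isomorphism between the action on the interpretation of a word and the interpretation of
the action on the word. -/
def ψ (g : G) : ∀ w : List (Letter 𝒞), (𝒞.str.γ g).obj (ev w) ≅ ev (act g w)
  | [] => (𝒞.str.φ g).symm
  | l :: w => (𝒞.str.J g l.ev (ev w) (homog_ev w)).symm ≪≫
      (l.ψ (P.ract (deg w) g) ⊗ᵢ ψ g w)

lemma J_ψ_cons (g : G) (l : Letter 𝒞) (w : List (Letter 𝒞)) :
    (𝒞.str.J g l.ev (ev w) (homog_ev w)).hom ≫ (ψ g (l :: w)).hom =
      (l.ψ (P.ract (deg w) g)).hom ⊗ₘ (ψ g w).hom := by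
  simp [ψ]

lemma eqToHom_cons {l l' : Letter 𝒞} {w w' : List (Letter 𝒞)} (hl : l = l') (hw : w = w')
    (h : ev (l :: w) = ev (l' :: w')) :
    eqToHom h = eqToHom (congrArg Letter.ev hl) ⊗ₘ eqToHom (congrArg ev hw) := by
  subst hl hw
  simp [ev]

lemma eqToHom_cons_tail (l : Letter 𝒞) {w w' : List (Letter 𝒞)} (hw : w = w')
    (h : ev (l :: w) = ev (l :: w')) : eqToHom h = l.ev ◁ eqToHom (congrArg ev hw) := by
  subst hw
  simp

lemma μ_assoc (a b c : List (Letter 𝒞)) :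
    (μ a b).hom ▷ ev c ≫ (μ (a ++ b) c).hom ≫ eqToHom (congrArg ev (List.append_assoc a b c)) =
      (α_ (ev a) (ev b) (ev c)).hom ≫ ev a ◁ (μ b c).hom ≫ (μ a (b ++ c)).hom := by
  induction a with
  | nil =>
    change (λ_ (ev b)).hom ▷ ev c ≫ (μ b c).hom ≫ 𝟙 _ =
      (α_ (𝟙_ _) (ev b) (ev c)).hom ≫ 𝟙_ _ ◁ (μ b c).hom ≫ (λ_ _).hom
    simp
  | cons l a ih =>
    change ((α_ l.ev (ev a) (ev b)).hom ≫ l.ev ◁ (μ a b).hom) ▷ ev c ≫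
        ((α_ l.ev (ev (a ++ b)) (ev c)).hom ≫ l.ev ◁ (μ (a ++ b) c).hom) ≫ _ =
      (α_ (l.ev ⊗ ev a) (ev b) (ev c)).hom ≫ (l.ev ⊗ ev a) ◁ (μ b c).hom ≫
        (α_ l.ev (ev a) (ev (b ++ c))).hom ≫ l.ev ◁ (μ a (b ++ c)).hom
    rw [eqToHom_cons_tail l (List.append_assoc a b c)]
    have h := congrArg (l.ev ◁ ·) ih
    simp only [MonoidalCategory.whiskerLeft_comp] at h
    simp [h, -whiskerLeft_eqToHom]

lemma μ_nil_right (a : List (Letter 𝒞)) :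
    (μ a []).hom ≫ eqToHom (congrArg ev (List.append_nil a)) = (ρ_ (ev a)).hom := by
  induction a with
  | nil =>
    change (λ_ (𝟙_ 𝒞.carrier)).hom ≫ 𝟙 _ = (ρ_ (𝟙_ 𝒞.carrier)).hom
    simp [unitors_equal]
  | cons l a ih =>
    change ((α_ l.ev (ev a) (𝟙_ 𝒞.carrier)).hom ≫ l.ev ◁ (μ a []).hom) ≫ _ =
      (ρ_ (l.ev ⊗ ev a)).hom
    rw [eqToHom_cons_tail l (List.append_nil a)]
    have h := congrArg (l.ev ◁ ·) ih
    simp only [MonoidalCategory.whiskerLeft_comp] at h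
    simp [h, -whiskerLeft_eqToHom]

/-- Induction on the word: `φ_χ` settles the empty word, and `J_χ` with naturality of J splits the
claim into one for the first letter and one for the tail. -/
lemma ψ_ψ (g h : G) (w : List (Letter 𝒞)) :
    (𝒞.str.γ g).map (ψ h w).hom ≫ (ψ g (act h w)).hom ≫ eqToHom (congrArg ev (act_mul g h w)) =
      (𝒞.str.χ g h).hom.app (ev w) ≫ (ψ (g * h) w).hom := by
  induction w with
  | nil =>
    change (𝒞.str.γ g).map (𝒞.str.φ h).inv ≫ (𝒞.str.φ g).inv ≫ 𝟙 _ =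
      (𝒞.str.χ g h).hom.app (𝟙_ _) ≫ (𝒞.str.φ (g * h)).inv
    have h1 := 𝒞.str.φ_χ g h
    rw [← cancel_mono (𝒞.str.φ (g * h)).hom, Category.assoc, Category.assoc, Category.assoc,
      Iso.inv_hom_id, ← h1]
    simp
  | cons l w ih =>
    have hJ := 𝒞.str.J_χ g h l.ev (ev w) (homog_ev w)
    -- `J_χ` yields J in the first degree while ψ uses the second; `J_congr` bridges them and
    -- `Letter.transp_ψ` absorbs the transport.
    have hd : P.lact h (deg w) = deg (act h w) := (deg_act h w).symm
    have hw : 𝒞.str.homog (P.lact h (deg w)) (ev (act h w)) := hd ▸ homog_ev (act h w)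
    have hn := 𝒞.str.J_natural g (𝒞.str.homog_γ h (homog_ev w)) hw
      (l.ψ (P.ract (deg w) h)).hom (ψ h w).hom
    have hc := 𝒞.str.J_congr g hd (l.act (P.ract (deg w) h)).ev (ev (act h w)) hw (homog_ev _)
    have hl := l.map_ψ (P.ract (P.lact h (deg w)) g) (P.ract (deg w) h)
    rw [← cancel_epi ((𝒞.str.γ g).map (𝒞.str.J h l.ev (ev w) (homog_ev w)).hom),
      ← cancel_epi (𝒞.str.J g _ _ (𝒞.str.homog_γ h (homog_ev w))).hom, reassoc_of% hJ,
      J_ψ_cons, ← Functor.map_comp_assoc, J_ψ_cons, ← reassoc_of% hn, hc, Category.assoc,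
      reassoc_of% @J_ψ_cons, eqToHom_cons ((Letter.act_mul _ _ _).trans (by rw [P.ract_mul, deg_act]))
        (act_mul g h w), ← tensorHom_id, tensorHom_comp_tensorHom, tensorHom_comp_tensorHom,
      tensorHom_comp_tensorHom, tensorHom_comp_tensorHom, Category.id_comp, ih,
      reassoc_of% @Letter.transp_ψ, eqToHom_trans, Category.assoc, Letter.transp_ψ, ← reassoc_of% hl,
      eqToHom_trans]

lemma ι_ψ (w : List (Letter 𝒞)) :
    𝒞.str.ι.hom.app (ev w) ≫ (ψ 1 w).hom = eqToHom (congrArg ev (one_act w).symm) := by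
  induction w with
  | nil =>
    change 𝒞.str.ι.hom.app (𝟙_ _) ≫ (𝒞.str.φ 1).inv = 𝟙 _
    rw [𝒞.str.φ_ι, Iso.hom_inv_id]
  | cons l w ih =>
    have hJ := 𝒞.str.J_ι l.ev (ev w) (homog_ev w)
    change 𝒞.str.ι.hom.app (l.ev ⊗ ev w) ≫ _ = _
    rw [hJ, Category.assoc, J_ψ_cons, tensorHom_comp_tensorHom, ih, Category.assoc,
      Letter.transp_ψ, reassoc_of% l.ι_ψ, eqToHom_trans]
    exact (eqToHom_cons (by rw [P.ract_one, l.one_act]) (one_act w).symm _).symm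

/-- Induction on `a`, with `J_unit_left` for the empty word and `J_assoc` to move the first letter
out of the product. -/
lemma J_ψ (g : G) (a b : List (Letter 𝒞)) :
    (𝒞.str.J g (ev a) (ev b) (homog_ev b)).hom ≫ (𝒞.str.γ g).map (μ a b).hom ≫
        (ψ g (a ++ b)).hom ≫ eqToHom (congrArg ev (act_append g a b)) =
      ((ψ (P.ract (deg b) g) a).hom ⊗ₘ (ψ g b).hom) ≫
        (μ (act (P.ract (deg b) g) a) (act g b)).hom := by
  induction a with
  | nil =>
    have h1 := 𝒞.str.J_unit_left g (ev b) (homog_ev b)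
    change (𝒞.str.J g (𝟙_ _) (ev b) (homog_ev b)).hom ≫ (𝒞.str.γ g).map (λ_ (ev b)).hom ≫
        (ψ g b).hom ≫ 𝟙 _ = ((𝒞.str.φ (P.ract (deg b) g)).inv ⊗ₘ (ψ g b).hom) ≫ (λ_ _).hom
    rw [← cancel_epi ((𝒞.str.φ (P.ract (deg b) g)).hom ▷ (𝒞.str.γ g).obj (ev b)),
      reassoc_of% h1]
    simp [MonoidalCategory.tensorHom_def]
  | cons l a ih =>
    have hJ := 𝒞.str.J_assoc g l.ev (ev a) (ev b) (homog_ev a) (homog_ev b)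
    have hd : deg a * deg b = deg (a ++ b) := (deg_append a b).symm
    have hab : 𝒞.str.homog (deg a * deg b) (ev (a ++ b)) := hd ▸ homog_ev (a ++ b)
    have hn := 𝒞.str.J_natural g (𝒞.str.homog_tensor (homog_ev a) (homog_ev b)) hab
      (𝟙 l.ev) (μ a b).hom
    have hc := 𝒞.str.J_congr g hd l.ev (ev (a ++ b)) hab (homog_ev _)
    rw [CategoryTheory.Functor.map_id, id_tensorHom, id_tensorHom] at hn
    change (𝒞.str.J g (l.ev ⊗ ev a) (ev b) (homog_ev b)).hom ≫
        (𝒞.str.γ g).map ((α_ l.ev (ev a) (ev b)).hom ≫ l.ev ◁ (μ a b).hom) ≫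
        (ψ g (l :: (a ++ b))).hom ≫ _ = ((ψ _ (l :: a)).hom ⊗ₘ (ψ g b).hom) ≫
          (α_ _ _ _).hom ≫ _ ◁ (μ _ _).hom
    have hg : P.ract (deg (a ++ b)) g = P.ract (deg a) (P.ract (deg b) g) := by
      rw [deg_append, P.mul_ract]
    rw [← cancel_epi ((𝒞.str.J (P.ract (deg b) g) l.ev (ev a) (homog_ev a)).hom ▷
        (𝒞.str.γ g).obj (ev b)), Functor.map_comp, Category.assoc, reassoc_of% hJ,
      ← reassoc_of% hn, hc, Category.assoc, reassoc_of% @J_ψ_cons,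
      eqToHom_cons (congrArg (Letter.act · l) hg) (act_append g a b),
      ← tensorHom_id, ← tensorHom_id, ← id_tensorHom, ← id_tensorHom, tensorHom_comp_tensorHom,
      tensorHom_comp_tensorHom, tensorHom_comp_tensorHom, tensorHom_comp_tensorHom_assoc,
      J_ψ_cons, associator_naturality_assoc, tensorHom_comp_tensorHom,
      Category.id_comp, Category.id_comp, Category.id_comp, ih, tensorHom_comp_tensorHom,
      reassoc_of% @Letter.transp_ψ, reassoc_of% @Letter.transp_ψ, eqToHom_trans, eqToHom_trans, eqToHom_refl]

end Word

/-! ### Direct sum decompositions and zero objects. -/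

/-- A decomposition of an object of a preadditive category as a finite direct sum. -/
structure DirectSum.Decomp {C : Type u} [Category.{v} C] [Preadditive C] {I : Type u₁}
    [Fintype I] (X : C) (Y : I → C) where
  ι : ∀ i, Y i ⟶ X
  π : ∀ i, X ⟶ Y i
  ι_π_self : ∀ i, ι i ≫ π i = 𝟙 (Y i)
  ι_π_ne : ∀ i k, i ≠ k → ι i ≫ π k = 0
  total : ∑ i, π i ≫ ι i = 𝟙 X

namespace DirectSum.Decomp

variable {C : Type u} [Category.{v} C] [Preadditive C] {I : Type u₁} [Fintype I] {X : C}
  {Y : I → C}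

lemma hom_ext (d : Decomp X Y) {Z : C} {f k : X ⟶ Z} (h : ∀ i, d.ι i ≫ f = d.ι i ≫ k) :
    f = k := by
  rw [← Category.id_comp f, ← Category.id_comp k, ← d.total, Preadditive.sum_comp,
    Preadditive.sum_comp]
  simp [h]

/-- The biproduct decomposition. -/
noncomputable def biproduct [HasFiniteBiproducts C] (Y : I → C) : Decomp (⨁ Y) Y where
  ι := biproduct.ι Y
  π := biproduct.π Y
  ι_π_self i := biproduct.ι_π_self Y i
  ι_π_ne _ _ h := biproduct.ι_π_ne Y h
  total := biproduct.hom_ext' _ _ fun i => by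
    rw [Preadditive.comp_sum, Finset.sum_eq_single i]
    · simp
    · intro k _ hk
      rw [biproduct.ι_π_ne_assoc _ hk.symm, zero_comp]
    · simp

/-- The image of a decomposition under an additive functor. -/
@[simps]
def map (d : Decomp X Y) {D : Type u₂} [Category.{v₂} D] [Preadditive D] (F : C ⥤ D)
    [F.Additive] : Decomp (F.obj X) (fun i => F.obj (Y i)) where
  ι i := F.map (d.ι i)
  π i := F.map (d.π i)
  ι_π_self i := by rw [← F.map_comp, d.ι_π_self, F.map_id]
  ι_π_ne i k h := by rw [← F.map_comp, d.ι_π_ne i k h, F.map_zero]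
  total := by simp only [← F.map_comp, ← F.map_sum, d.total, F.map_id]

/-- The tensor product of two decompositions. -/
@[simps]
def tensor [MonoidalCategory C] [MonoidalPreadditive C] {K : Type u₂} [Fintype K] {X' : C}
    {Y' : K → C} (d : Decomp X Y) (d' : Decomp X' Y') :
    Decomp (X ⊗ X') (fun p : I × K => Y p.1 ⊗ Y' p.2) where
  ι p := d.ι p.1 ⊗ₘ d'.ι p.2
  π p := d.π p.1 ⊗ₘ d'.π p.2
  ι_π_self p := by rw [tensorHom_comp_tensorHom, d.ι_π_self, d'.ι_π_self, id_tensorHom_id]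
  ι_π_ne p q h := by
    rw [tensorHom_comp_tensorHom]
    by_cases h1 : p.1 = q.1
    · rw [d'.ι_π_ne _ _ fun h2 => h (Prod.ext h1 h2), MonoidalPreadditive.tensor_zero]
    · rw [d.ι_π_ne _ _ h1, MonoidalPreadditive.zero_tensor]
  total := by
    simp only [tensorHom_comp_tensorHom, Fintype.sum_prod_type, ← tensor_sum, ← sum_tensor,
      d.total, d'.total, id_tensorHom_id]

/-- The trivial decomposition. -/
@[simps]
def self (X : C) : Decomp X (fun _ : Unit => X) where
  ι _ := 𝟙 X
  π _ := 𝟙 X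
  ι_π_self _ := by simp
  ι_π_ne _ _ h := (h rfl).elim
  total := by simp

end DirectSum.Decomp

open DirectSum

lemma isZero_tensor_left {C : Type u} [Category.{v} C] [Preadditive C] [MonoidalCategory C]
    [MonoidalPreadditive C] {X : C} (h : IsZero X) (Y : C) : IsZero (X ⊗ Y) := by
  rw [IsZero.iff_id_eq_zero, ← id_tensorHom_id, (IsZero.iff_id_eq_zero X).1 h,
    MonoidalPreadditive.zero_tensor]

lemma isZero_tensor_right {C : Type u} [Category.{v} C] [Preadditive C] [MonoidalCategory C]
    [MonoidalPreadditive C] (X : C) {Y : C} (h : IsZero Y) : IsZero (X ⊗ Y) := by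
  rw [IsZero.iff_id_eq_zero, ← id_tensorHom_id, (IsZero.iff_id_eq_zero Y).1 h,
    MonoidalPreadditive.tensor_zero]

lemma CatAction.isZero_γ {C : Type u} [Category.{v} C] [Preadditive C] (A : CatAction G C) (g : G)
    {X : C} (h : IsZero X) : IsZero ((A.γ g).obj X) := by
  have := A.additive g
  exact (A.γ g).map_isZero h

/-- γ(g⁻¹) undoes γ(g) up to isomorphism. Hence the action on formal sums never creates or destroys
zero words. -/
lemma CatAction.isZero_γ_iff {C : Type u} [Category.{v} C] [Preadditive C] (A : CatAction G C)
    (g : G) {X : C} : IsZero ((A.γ g).obj X) ↔ IsZero X := by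
  refine ⟨fun h => ?_, A.isZero_γ g⟩
  have e : (A.γ g⁻¹).obj ((A.γ g).obj X) ≅ X := (A.χ g⁻¹ g).app X ≪≫
    eqToIso (by rw [inv_mul_cancel]) ≪≫ A.ι.symm.app X
  exact (A.isZero_γ g⁻¹ h).of_iso e.symm

namespace Word

lemma isZero_append_left {a : List (Letter 𝒞)} (h : IsZero (ev a)) (b : List (Letter 𝒞)) :
    IsZero (ev (a ++ b)) := (isZero_tensor_left h _).of_iso (μ a b).symm

lemma isZero_append_right (a : List (Letter 𝒞)) {b : List (Letter 𝒞)} (h : IsZero (ev b)) :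
    IsZero (ev (a ++ b)) := (isZero_tensor_right _ h).of_iso (μ a b).symm

lemma isZero_act_iff (g : G) {w : List (Letter 𝒞)} : IsZero (ev (act g w)) ↔ IsZero (ev w) :=
  (ψ g w).isZero_iff.symm.trans (𝒞.str.isZero_γ_iff g)

lemma act_injective (g : G) : Function.Injective (act (𝒞 := 𝒞) g) := fun a b h => by
  rw [← one_act a, ← one_act b, ← inv_mul_cancel g, ← act_mul, ← act_mul, h]

end Word

/-! ### Formal direct sums of words. -/

/-- A formal direct sum of words of a common length, with non-zero interpretations. -/
@[ext]
structure SumOfWords (𝒞 : CrossedMonoidalCat.{v, u} P) : Type (max u v w₁ w₂) where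
  words : Finset (List (Letter 𝒞))
  not_isZero : ∀ w ∈ words, ¬ IsZero (Word.ev w)
  exists_length : ∃ n, ∀ w ∈ words, w.length = n

namespace SumOfWords

/-- The interpretation of a formal direct sum of words. -/
noncomputable def ev (A : SumOfWords 𝒞) : 𝒞.carrier := ⨁ fun w : A.words => Word.ev w.1

/-- The tautological decomposition of the interpretation of a formal direct sum. -/
noncomputable def decomp (A : SumOfWords 𝒞) : Decomp A.ev fun w : A.words => Word.ev w.1 :=
  Decomp.biproduct _

/-- A word which is either a summand or has zero interpretation. -/
def Supports (A : SumOfWords 𝒞) (w : List (Letter 𝒞)) : Prop :=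
  w ∈ A.words ∨ IsZero (Word.ev w)

open Classical in
/-- The inclusion of a word into a formal direct sum, zero if the word is not a summand. -/
noncomputable def ι (A : SumOfWords 𝒞) (w : List (Letter 𝒞)) : Word.ev w ⟶ A.ev :=
  if h : w ∈ A.words then A.decomp.ι ⟨w, h⟩ else 0

open Classical in
/-- The projection of a formal direct sum to a word, zero if the word is not a summand. -/
noncomputable def π (A : SumOfWords 𝒞) (w : List (Letter 𝒞)) : A.ev ⟶ Word.ev w :=
  if h : w ∈ A.words then A.decomp.π ⟨w, h⟩ else 0

lemma decomp_ι (A : SumOfWords 𝒞) (w : A.words) : A.decomp.ι w = A.ι w.1 := by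
  simp [ι, w.2]

lemma hom_ext {A : SumOfWords 𝒞} {Z : 𝒞.carrier} {f k : A.ev ⟶ Z}
    (h : ∀ w ∈ A.words, A.ι w ≫ f = A.ι w ≫ k) : f = k :=
  A.decomp.hom_ext fun w => by rw [decomp_ι, h _ w.2]

lemma ι_π_self (A : SumOfWords 𝒞) {w : List (Letter 𝒞)} (h : A.Supports w) :
    A.ι w ≫ A.π w = 𝟙 _ := by
  obtain h | h := h
  · simp [ι, π, h, A.decomp.ι_π_self]
  · exact h.eq_of_src _ _

lemma ι_π_ne (A : SumOfWords 𝒞) {w w' : List (Letter 𝒞)} (h : w ≠ w') :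
    A.ι w ≫ A.π w' = 0 := by
  unfold ι π
  split_ifs
  · exact A.decomp.ι_π_ne _ _ fun e => h (congrArg Subtype.val e)
  all_goals simp

/-- Inclusions are defined for all words, so transport along equalities involves no membership
proofs. -/
lemma ι_comp_eqToHom {A A' : SumOfWords 𝒞} (h : A = A') {w w' : List (Letter 𝒞)} (hw : w = w') :
    A.ι w ≫ eqToHom (congrArg ev h) = eqToHom (congrArg Word.ev hw) ≫ A'.ι w' := by
  subst h hw
  simp

/-- Injectivity of σ keeps distinct summands orthogonal, and dropping zero summands changes nothing.
All comparison isomorphisms arise from this, together with their values on summands. -/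
lemma exists_iso {X : 𝒞.carrier} {I : Type*} [Fintype I] {Y : I → 𝒞.carrier} (d : Decomp X Y)
    (A : SumOfWords 𝒞) (σ : I → List (Letter 𝒞)) (hσ : Function.Injective σ)
    (hA : ∀ w, w ∈ A.words ↔ (∃ i, σ i = w) ∧ ¬ IsZero (Word.ev w))
    (e : ∀ i, Y i ≅ Word.ev (σ i)) :
    ∃ f : X ≅ A.ev, ∀ i, d.ι i ≫ f.hom = (e i).hom ≫ A.ι (σ i) := by
  have hs : ∀ i, A.Supports (σ i) := fun i => by
    by_cases hz : IsZero (Word.ev (σ i))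
    · exact .inr hz
    · exact .inl ((hA _).2 ⟨⟨i, rfl⟩, hz⟩)
  let p : X ⟶ A.ev := ∑ i, d.π i ≫ (e i).hom ≫ A.ι (σ i)
  let q : A.ev ⟶ X := ∑ i, A.π (σ i) ≫ (e i).inv ≫ d.ι i
  have hp : ∀ i, d.ι i ≫ p = (e i).hom ≫ A.ι (σ i) := fun i => by
    rw [Preadditive.comp_sum, Finset.sum_eq_single i]
    · rw [← Category.assoc, d.ι_π_self, Category.id_comp]
    · intro k _ hk
      rw [← Category.assoc, d.ι_π_ne i k hk.symm, zero_comp]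
    · simp
  have hq : ∀ i, A.ι (σ i) ≫ q = (e i).inv ≫ d.ι i := fun i => by
    rw [Preadditive.comp_sum, Finset.sum_eq_single i]
    · rw [← Category.assoc, A.ι_π_self (hs i), Category.id_comp]
    · intro k _ hk
      rw [← Category.assoc, A.ι_π_ne fun h => hk.symm (hσ h), zero_comp]
    · simp
  refine ⟨⟨p, q, d.hom_ext fun i => ?_, hom_ext fun w hw => ?_⟩, hp⟩
  · rw [← Category.assoc, hp, Category.assoc, hq]
    simp
  · obtain ⟨⟨i, rfl⟩, -⟩ := (hA w).1 hw
    rw [← Category.assoc, hq, Category.assoc, hp]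
    simp

open Classical in
/-- The formal unit. -/
noncomputable def one : SumOfWords 𝒞 where
  words := ({[]} : Finset (List (Letter 𝒞))).filter fun w => ¬ IsZero (Word.ev w)
  not_isZero w hw := (Finset.mem_filter.1 hw).2
  exists_length := ⟨0, fun w hw => by
    rw [Finset.mem_singleton.1 (Finset.mem_filter.1 hw).1, List.length_nil]⟩

open Classical in
/-- The formal tensor product. -/
noncomputable def tens (A B : SumOfWords 𝒞) : SumOfWords 𝒞 where
  words := (Finset.image₂ (· ++ ·) A.words B.words).filter fun w => ¬ IsZero (Word.ev w)
  not_isZero w hw := (Finset.mem_filter.1 hw).2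
  exists_length := by
    obtain ⟨n, hn⟩ := A.exists_length
    obtain ⟨m, hm⟩ := B.exists_length
    refine ⟨n + m, fun w hw => ?_⟩
    obtain ⟨a, ha, b, hb, rfl⟩ := Finset.mem_image₂.1 (Finset.mem_filter.1 hw).1
    rw [List.length_append, hn a ha, hm b hb]

open Classical in
/-- The formal action. -/
noncomputable def act (g : G) (A : SumOfWords 𝒞) : SumOfWords 𝒞 where
  words := A.words.image (Word.act g)
  not_isZero w hw := by
    obtain ⟨a, ha, rfl⟩ := Finset.mem_image.1 hw
    rw [Word.isZero_act_iff]
    exact A.not_isZero a ha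
  exists_length := by
    obtain ⟨n, hn⟩ := A.exists_length
    refine ⟨n, fun w hw => ?_⟩
    obtain ⟨a, ha, rfl⟩ := Finset.mem_image.1 hw
    rw [Word.length_act, hn a ha]

lemma mem_one {w : List (Letter 𝒞)} :
    w ∈ (one : SumOfWords 𝒞).words ↔ w = [] ∧ ¬ IsZero (Word.ev w) := by
  simp [one]

lemma mem_tens {A B : SumOfWords 𝒞} {w : List (Letter 𝒞)} :
    w ∈ (tens A B).words ↔
      (∃ a ∈ A.words, ∃ b ∈ B.words, a ++ b = w) ∧ ¬ IsZero (Word.ev w) := by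
  simp [tens]

lemma mem_act {g : G} {A : SumOfWords 𝒞} {w : List (Letter 𝒞)} :
    w ∈ (act g A).words ↔ ∃ a ∈ A.words, Word.act g a = w := by
  simp [act]

/-- Discarding zero words at an intermediate stage is harmless: a word with a zero factor is itself
zero. -/
lemma tens_assoc (A B C : SumOfWords 𝒞) : tens (tens A B) C = tens A (tens B C) := by
  ext w
  simp only [mem_tens]
  refine and_congr_left fun hw => ⟨?_, ?_⟩
  · rintro ⟨_, ⟨⟨a, ha, b, hb, rfl⟩, -⟩, c, hc, rfl⟩
    rw [List.append_assoc] at hw ⊢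
    exact ⟨a, ha, _, ⟨⟨b, hb, c, hc, rfl⟩, fun h => hw (Word.isZero_append_right a h)⟩, rfl⟩
  · rintro ⟨a, ha, _, ⟨⟨b, hb, c, hc, rfl⟩, -⟩, rfl⟩
    rw [← List.append_assoc] at hw ⊢
    exact ⟨_, ⟨⟨a, ha, b, hb, rfl⟩, fun h => hw (Word.isZero_append_left h c)⟩, c, hc, rfl⟩

lemma one_tens (A : SumOfWords 𝒞) : tens one A = A := by
  ext w
  simp only [mem_tens, mem_one]
  constructor
  · rintro ⟨⟨_, ⟨rfl, -⟩, b, hb, rfl⟩, -⟩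
    exact hb
  · intro hw
    have hz := A.not_isZero w hw
    exact ⟨⟨[], ⟨rfl, fun h => hz (Word.isZero_append_left h w)⟩, w, hw, rfl⟩, hz⟩

lemma tens_one (A : SumOfWords 𝒞) : tens A one = A := by
  ext w
  simp only [mem_tens, mem_one]
  constructor
  · rintro ⟨⟨a, ha, _, ⟨rfl, -⟩, rfl⟩, -⟩
    rwa [List.append_nil]
  · intro hw
    have hz := A.not_isZero w hw
    refine ⟨⟨w, hw, [], ⟨rfl, fun h => hz ?_⟩, List.append_nil w⟩, hz⟩
    have := Word.isZero_append_right w h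
    rwa [List.append_nil] at this

lemma act_mul (g h : G) (A : SumOfWords 𝒞) : act g (act h A) = act (g * h) A := by
  ext w
  simp [mem_act, Word.act_mul]

lemma one_act (A : SumOfWords 𝒞) : act 1 A = A := by
  ext w
  simp [mem_act, Word.one_act]

lemma act_unit (g : G) : act g (one : SumOfWords 𝒞) = one := by
  ext w
  simp only [mem_act, mem_one]
  constructor
  · rintro ⟨_, ⟨rfl, h⟩, rfl⟩
    exact ⟨rfl, h⟩
  · rintro ⟨rfl, h⟩
    exact ⟨[], ⟨rfl, h⟩, rfl⟩

/-- Otherwise the projection to the summand would vanish between different degrees, and the summand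
would be zero. -/
lemma deg_eq {s : Γ} {A : SumOfWords 𝒞} (hA : 𝒞.str.homog s A.ev) {w : List (Letter 𝒞)}
    (hw : w ∈ A.words) : s = Word.deg w := by
  by_contra h
  refine A.not_isZero w hw ((IsZero.iff_id_eq_zero _).2 ?_)
  rw [← A.ι_π_self (.inl hw), 𝒞.str.hom_eq_zero h hA (Word.homog_ev w) (A.π w), comp_zero]

lemma act_tens (g : G) {s : Γ} (A B : SumOfWords 𝒞) (hB : 𝒞.str.homog s B.ev) :
    act g (tens A B) = tens (act (P.ract s g) A) (act g B) := by
  ext w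
  simp only [mem_act, mem_tens]
  constructor
  · rintro ⟨_, ⟨⟨a, ha, b, hb, rfl⟩, hz⟩, rfl⟩
    refine ⟨⟨_, ⟨a, ha, rfl⟩, _, ⟨b, hb, rfl⟩, ?_⟩, (Word.isZero_act_iff g).not.2 hz⟩
    rw [Word.act_append, deg_eq hB hb]
  · rintro ⟨⟨_, ⟨a, ha, rfl⟩, _, ⟨b, hb, rfl⟩, rfl⟩, hz⟩
    rw [deg_eq hB hb, ← Word.act_append] at hz ⊢
    exact ⟨_, ⟨⟨a, ha, b, hb, rfl⟩, (Word.isZero_act_iff g).not.1 hz⟩, rfl⟩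

lemma supports_nil : (one : SumOfWords 𝒞).Supports [] := by
  by_cases hz : IsZero (Word.ev ([] : List (Letter 𝒞)))
  · exact .inr hz
  · exact .inl (mem_one.2 ⟨rfl, hz⟩)

lemma supports_append {A B : SumOfWords 𝒞} {a b : List (Letter 𝒞)} (ha : A.Supports a)
    (hb : B.Supports b) : (tens A B).Supports (a ++ b) := by
  obtain ha | ha := ha
  · obtain hb | hb := hb
    · by_cases hz : IsZero (Word.ev (a ++ b))
      · exact .inr hz
      · exact .inl (mem_tens.2 ⟨⟨a, ha, b, hb, rfl⟩, hz⟩)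
    · exact .inr (Word.isZero_append_right a hb)
  · exact .inr (Word.isZero_append_left ha b)

lemma supports_act (g : G) {A : SumOfWords 𝒞} {a : List (Letter 𝒞)} (ha : A.Supports a) :
    (act g A).Supports (Word.act g a) :=
  ha.imp (fun h => mem_act.2 ⟨a, h, rfl⟩) (Word.isZero_act_iff g).2

lemma exists_ε : ∃ f : 𝟙_ 𝒞.carrier ≅ (one : SumOfWords 𝒞).ev, f.hom = one.ι [] := by
  obtain ⟨f, hf⟩ := exists_iso (Decomp.self (𝟙_ 𝒞.carrier)) (one : SumOfWords 𝒞) (fun _ => [])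
    (fun _ _ _ => rfl) (fun w => by simp [mem_one, eq_comm]) (fun _ => Iso.refl _)
  exact ⟨f, by simpa using hf ()⟩

lemma exists_μ (A B : SumOfWords 𝒞) : ∃ f : A.ev ⊗ B.ev ≅ (tens A B).ev,
    ∀ a b, A.Supports a → B.Supports b →
      (A.ι a ⊗ₘ B.ι b) ≫ f.hom = (Word.μ a b).hom ≫ (tens A B).ι (a ++ b) := by
  obtain ⟨f, hf⟩ := exists_iso (A.decomp.tensor B.decomp) (tens A B)
    -- The common length of the words of `A` makes the splitting of a concatenation unique.
    (fun p => p.1.1 ++ p.2.1) (fun p q h => by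
      obtain ⟨n, hn⟩ := A.exists_length
      obtain ⟨h1, h2⟩ := List.append_inj h ((hn _ p.1.2).trans (hn _ q.1.2).symm)
      exact Prod.ext (Subtype.ext h1) (Subtype.ext h2))
    (fun w => by simp [mem_tens]) (fun p => Word.μ p.1.1 p.2.1)
  refine ⟨f, fun a b ha hb => ?_⟩
  obtain ha | ha := ha
  · obtain hb | hb := hb
    · simpa [decomp_ι] using hf (⟨a, ha⟩, ⟨b, hb⟩)
    · exact (isZero_tensor_right _ hb).eq_of_src _ _
  · exact (isZero_tensor_left ha _).eq_of_src _ _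

lemma exists_ψ (g : G) (A : SumOfWords 𝒞) : ∃ f : (𝒞.str.γ g).obj A.ev ≅ (act g A).ev,
    ∀ a, A.Supports a →
      (𝒞.str.γ g).map (A.ι a) ≫ f.hom = (Word.ψ g a).hom ≫ (act g A).ι (Word.act g a) := by
  have := 𝒞.str.additive g
  obtain ⟨f, hf⟩ := exists_iso (A.decomp.map (𝒞.str.γ g)) (act g A)
    (fun w => Word.act g w.1) (fun p q h => Subtype.ext (Word.act_injective g h))
    (fun w => by
      refine ⟨fun h => ⟨?_, (act g A).not_isZero w h⟩, fun h => mem_act.2 ?_⟩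
      · obtain ⟨a, ha, rfl⟩ := mem_act.1 h
        exact ⟨⟨a, ha⟩, rfl⟩
      · obtain ⟨⟨a, rfl⟩, -⟩ := h
        exact ⟨a.1, a.2, rfl⟩) (fun w => Word.ψ g w.1)
  refine ⟨f, fun a ha => ?_⟩
  obtain ha | ha := ha
  · simpa [decomp_ι] using hf ⟨a, ha⟩
  · exact (𝒞.str.isZero_γ g ha).eq_of_src _ _

/-- The interpretation of the formal unit. -/
noncomputable def ε : 𝟙_ 𝒞.carrier ≅ (one : SumOfWords 𝒞).ev := exists_ε.choose

lemma ε_hom : (ε (𝒞 := 𝒞)).hom = one.ι [] := exists_ε.choose_spec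

/-- The interpretation of the formal tensor product. -/
noncomputable def μ (A B : SumOfWords 𝒞) : A.ev ⊗ B.ev ≅ (tens A B).ev := (exists_μ A B).choose

lemma ι_μ {A B : SumOfWords 𝒞} {a b : List (Letter 𝒞)} (ha : A.Supports a) (hb : B.Supports b) :
    (A.ι a ⊗ₘ B.ι b) ≫ (μ A B).hom = (Word.μ a b).hom ≫ (tens A B).ι (a ++ b) :=
  (exists_μ A B).choose_spec a b ha hb

/-- The interpretation of the formal action. -/
noncomputable def ψ (g : G) (A : SumOfWords 𝒞) : (𝒞.str.γ g).obj A.ev ≅ (act g A).ev :=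
  (exists_ψ g A).choose

lemma ι_ψ (g : G) {A : SumOfWords 𝒞} {a : List (Letter 𝒞)} (ha : A.Supports a) :
    (𝒞.str.γ g).map (A.ι a) ≫ (ψ g A).hom = (Word.ψ g a).hom ≫ (act g A).ι (Word.act g a) :=
  (exists_ψ g A).choose_spec a ha

lemma exists_ev_iso (X : 𝒞.carrier) : ∃ A : SumOfWords 𝒞, Nonempty (A.ev ≅ X) := by
  classical
  obtain ⟨n, d, Y, hY, ⟨e⟩⟩ := 𝒞.str.exists_decomposition X
  -- One-letter words with trivial group element; the label i keeps repeated summands distinct in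
  -- the set.
  let σ : Fin n → List (Letter 𝒞) := fun i => [⟨i, 1, d i, Y i, hY i⟩]
  let A : SumOfWords 𝒞 :=
    { words := (Finset.univ.image σ).filter fun w => ¬ IsZero (Word.ev w)
      not_isZero := fun w hw => (Finset.mem_filter.1 hw).2
      exists_length := ⟨1, fun w hw => by
        obtain ⟨i, -, rfl⟩ := Finset.mem_image.1 (Finset.mem_filter.1 hw).1
        rfl⟩ }
  obtain ⟨f, -⟩ := exists_iso (Decomp.biproduct Y) A σ
    (fun i k h => by simpa [σ, Fin.ext_iff] using congrArg (List.map Letter.label) h)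
    (fun w => by simp [A]) (fun i => 𝒞.str.ι.app (Y i) ≪≫ (ρ_ _).symm)
  exact ⟨A, ⟨f.symm ≪≫ e.symm⟩⟩

/-- Morphisms out of a direct sum are determined on summands, where the claim is the one for words.
The other coherence laws below are reduced in the same way. -/
lemma μ_assoc (A B C : SumOfWords 𝒞) :
    (μ A B).hom ▷ C.ev ≫ (μ (tens A B) C).hom ≫ eqToHom (congrArg ev (tens_assoc A B C)) =
      (α_ A.ev B.ev C.ev).hom ≫ A.ev ◁ (μ B C).hom ≫ (μ A (tens B C)).hom := by
  refine ((A.decomp.tensor B.decomp).tensor C.decomp).hom_ext fun p => ?_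
  obtain ⟨⟨⟨a, ha⟩, b, hb⟩, c, hc⟩ := p
  replace ha : A.Supports a := .inl ha
  replace hb : B.Supports b := .inl hb
  replace hc : C.Supports c := .inl hc
  simp only [Decomp.tensor_ι, decomp_ι]
  have h1 : ((Word.μ a b).hom ≫ (tens A B).ι (a ++ b)) ⊗ₘ C.ι c =
      (Word.μ a b).hom ▷ Word.ev c ≫ ((tens A B).ι (a ++ b) ⊗ₘ C.ι c) := by
    rw [← tensorHom_id, tensorHom_comp_tensorHom, Category.id_comp]
  have h2 : A.ι a ⊗ₘ ((Word.μ b c).hom ≫ (tens B C).ι (b ++ c)) =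
      Word.ev a ◁ (Word.μ b c).hom ≫ (A.ι a ⊗ₘ (tens B C).ι (b ++ c)) := by
    rw [← id_tensorHom, tensorHom_comp_tensorHom, Category.id_comp]
  rw [← tensorHom_id, tensorHom_comp_tensorHom_assoc, ι_μ ha hb, ← id_tensorHom,
    associator_naturality_assoc, tensorHom_comp_tensorHom_assoc, ι_μ hb hc, Category.comp_id,
    Category.comp_id, h1, h2, Category.assoc, Category.assoc, reassoc_of% (ι_μ (supports_append ha hb) hc),
    ι_μ ha (supports_append hb hc), ι_comp_eqToHom (tens_assoc A B C) (List.append_assoc a b c)]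
  exact (by simpa only [Category.assoc] using Word.μ_assoc a b c =≫ _)

lemma ε_μ (A : SumOfWords 𝒞) :
    ε.hom ▷ A.ev ≫ (μ one A).hom ≫ eqToHom (congrArg ev (one_tens A)) = (λ_ A.ev).hom := by
  refine ((Decomp.self (𝟙_ _)).tensor A.decomp).hom_ext fun p => ?_
  obtain ⟨⟨⟩, a, ha⟩ := p
  replace ha : A.Supports a := .inl ha
  simp only [Decomp.tensor_ι, Decomp.self_ι, decomp_ι]
  rw [← tensorHom_id, tensorHom_comp_tensorHom_assoc, Category.id_comp, Category.comp_id, ε_hom,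
    id_tensorHom, leftUnitor_naturality]
  refine ((reassoc_of% (ι_μ supports_nil ha)) _).trans ?_
  exact congrArg _ ((ι_comp_eqToHom (one_tens A) (List.nil_append a)).trans (Category.id_comp _))

lemma μ_ε (A : SumOfWords 𝒞) :
    A.ev ◁ ε.hom ≫ (μ A one).hom ≫ eqToHom (congrArg ev (tens_one A)) = (ρ_ A.ev).hom := by
  refine (A.decomp.tensor (Decomp.self (𝟙_ _))).hom_ext fun p => ?_
  obtain ⟨⟨a, ha⟩, ⟨⟩⟩ := p
  replace ha : A.Supports a := .inl ha
  simp only [Decomp.tensor_ι, Decomp.self_ι, decomp_ι]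
  rw [← id_tensorHom, tensorHom_comp_tensorHom_assoc, Category.id_comp, Category.comp_id, ε_hom,
    tensorHom_id, rightUnitor_naturality]
  refine ((reassoc_of% (ι_μ ha supports_nil)) _).trans ?_
  rw [ι_comp_eqToHom (tens_one A) (List.append_nil a), ← Category.assoc, Word.μ_nil_right]

lemma ψ_ψ (g h : G) (A : SumOfWords 𝒞) :
    (𝒞.str.γ g).map (ψ h A).hom ≫ (ψ g (act h A)).hom ≫ eqToHom (congrArg ev (act_mul g h A)) =
      (𝒞.str.χ g h).hom.app A.ev ≫ (ψ (g * h) A).hom := by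
  have := 𝒞.str.additive g
  have := 𝒞.str.additive h
  refine ((A.decomp.map (𝒞.str.γ h)).map (𝒞.str.γ g)).hom_ext fun ⟨a, ha⟩ => ?_
  replace ha : A.Supports a := .inl ha
  have h1 := (𝒞.str.χ g h).hom.naturality (A.ι a)
  simp only [Functor.comp_map, Functor.comp_obj] at h1
  simp only [Decomp.map_ι, decomp_ι]
  rw [reassoc_of% h1, ι_ψ _ ha, ← Functor.map_comp_assoc, ι_ψ _ ha, Functor.map_comp,
    Category.assoc, reassoc_of% (ι_ψ _ (supports_act h ha)),
    ι_comp_eqToHom (act_mul g h A) (Word.act_mul g h a)]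
  simpa only [Category.assoc] using Word.ψ_ψ g h a =≫ _

lemma unit_ψ (A : SumOfWords 𝒞) :
    𝒞.str.ι.hom.app A.ev ≫ (ψ 1 A).hom = eqToHom (congrArg ev (one_act A).symm) := by
  refine hom_ext fun a ha => ?_
  have h1 := 𝒞.str.ι.hom.naturality (A.ι a)
  simp only [Functor.id_map, Functor.id_obj] at h1
  rw [reassoc_of% h1, ι_ψ 1 (.inl ha), ← Category.assoc, Word.ι_ψ,
    ι_comp_eqToHom (one_act A).symm (Word.one_act a).symm]

lemma J_ψ (g : G) {s : Γ} (A B : SumOfWords 𝒞) (hB : 𝒞.str.homog s B.ev) :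
    (𝒞.str.J g A.ev B.ev hB).hom ≫ (𝒞.str.γ g).map (μ A B).hom ≫ (ψ g (tens A B)).hom ≫
        eqToHom (congrArg ev (act_tens g A B hB)) =
      ((ψ (P.ract s g) A).hom ⊗ₘ (ψ g B).hom) ≫ (μ (act (P.ract s g) A) (act g B)).hom := by
  have := 𝒞.str.additive g
  have := 𝒞.str.additive (P.ract s g)
  refine ((A.decomp.map (𝒞.str.γ (P.ract s g))).tensor
    (B.decomp.map (𝒞.str.γ g))).hom_ext fun ⟨⟨a, ha⟩, b, hb⟩ => ?_
  -- A summand of `B` is at hand, so the given degree can be replaced by that of the word, as the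
  -- lemma on words requires.
  obtain rfl := deg_eq hB hb
  replace ha : A.Supports a := .inl ha
  replace hb : B.Supports b := .inl hb
  have h1 := 𝒞.str.J_natural g (Word.homog_ev b) hB (A.ι a) (B.ι b)
  have h2 : ((Word.ψ (P.ract (Word.deg b) g) a).hom ≫ (act (P.ract (Word.deg b) g) A).ι _) ⊗ₘ
      ((Word.ψ g b).hom ≫ (act g B).ι _) = _ := (tensorHom_comp_tensorHom _ _ _ _).symm
  simp only [Decomp.tensor_ι, Decomp.map_ι, decomp_ι]
  rw [reassoc_of% h1, tensorHom_comp_tensorHom_assoc, ι_ψ _ ha, ι_ψ _ hb, h2, Category.assoc,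
    ι_μ (supports_act _ ha) (supports_act _ hb), ← Functor.map_comp_assoc, ι_μ ha hb,
    Functor.map_comp, Category.assoc, reassoc_of% (ι_ψ _ (supports_append ha hb)),
    ι_comp_eqToHom (act_tens g A B hB) (Word.act_append g a b)]
  simpa only [Category.assoc] using Word.J_ψ g a b =≫ _

/-- The strict model of formal direct sums of words. -/
noncomputable def strictModel (𝒞 : CrossedMonoidalCat.{v, u} P) :
    StrictModel.{v, u, max u v w₁ w₂} 𝒞 where
  Obj := SumOfWords 𝒞
  ev := ev
  exists_ev_iso := exists_ev_iso
  one := one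
  tens := tens
  act := act
  tens_assoc := tens_assoc
  one_tens := one_tens
  tens_one := tens_one
  act_mul := act_mul
  one_act := one_act
  act_tens g _ := act_tens g
  act_unit := act_unit
  ε := ε
  μ := μ
  ψ := ψ
  μ_assoc := μ_assoc
  ε_μ := ε_μ
  μ_ε := μ_ε
  ψ_ψ := ψ_ψ
  ι_ψ := unit_ψ
  J_ψ g _ := J_ψ g

end SumOfWords

end Words

theorem mainTheorem2 {G : Type w₁} {Γ : Type w₂} [Group G] [Group Γ] (P : MatchedPair G Γ)
    (𝒞 : CrossedMonoidalCat.{v, u} P) :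
    ∃ 𝒟 : CrossedMonoidalCat.{v, max u v w₁ w₂} P,
      𝒟.IsStrictMonoidal ∧ 𝒟.IsStrictlyCrossed ∧
        ∃ F : CrossedFunctor 𝒞 𝒟, F.IsCrossedEquivalence :=
  (SumOfWords.strictModel 𝒞).exists_equivalence
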